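/- **Setting.** Euler's elastic problem on $M=\mathbb R^2_{x,y}\times S^1_\theta$: $\dot x=\cos\theta$, $\dot y=\sin\theta$, $\dot\theta=u$, $q_0=(0,0,0)$, $J_t=\frac12\int_0^t u^2\,ds$. Let $N=T^*_{q_0}M\cong\mathbb R^3$ with coordinates $h_i(\nu)=\langle\nu,X_i\rangle$, where $X_1=\cos\theta\,\partial_x+\sin\theta\,\partial_y$, $X_2=\partial_\theta$, $X_3=\sin\theta\,\partial_x-\cos\theta\,\partial_y$, and put $h_1=-r\cos\beta$, $h_2=c$, $h_3=-r\sin\beta$, $r\ge 0$. The normal extremal with initial covector $\nu$ is the solution of $\dot h_1=-h_2h_3$, $\dot h_2=h_3$, $\dot h_3=h_1h_2$ (equivalently $\dot\beta=c$, $\dot c=-r\sin\beta$, $\dot r=0$), $\dot x=\cos\theta$, $\dot y=\sin\theta$, $\dot\theta=c$, with $q_0=(x,y,\theta)(0)=(0,0,0)$; its control is $u(s)=c_s$, and $q_s=(x_s,y_s,\theta_s)=\mathrm{Exp}_s(\nu)$. Let $E=\frac{c^2}2-r\cos\beta$ and $N_1=\{r\ne0,\ -r<E<r\}$, $N_2=\{r\ne0,\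 E>r\}$, $N_3=\{r\ne0,\ E=r,\ \beta\ne\pi\}$, $N_4=\{r\ne0,\ E=-r\}$, $N_5=\{r\neq0,\ E=r,\ \beta=\pi\}$, $N_6=\{r=0,\ c\ne0\}$, $N_7=\{r=c=0\}$. For $t>0$ the reflections $\varepsilon^i:N\to N$, $\nu\mapsto\nu^i$, keep $r$ and are given by $(\beta^1,c^1)=(\beta_t,-c_t)$, $(\beta^2,c^2)=(-\beta_t,c_t)$, $(\beta^3,c^3)=(-\beta,-c)$. Let $q^i_s=\mathrm{Exp}_s(\nu^i)$, let $u^i$ be the control of that extremal, and $$\mathrm{MAX}^i_t=\{\nu\in N\mid q^i_s\not\equiv q_s \text{ on } [0,t],\ q^i_t=q_t,\ J_t[q,u]=J_t[q^i,u^i]\},\qquad i=1,2,3.$$ Let $P=x\sin\frac\theta2-y\cos\frac\theta2$ (defined up to sign), $P_t=P(q_t)$. Elliptic coordinates (Jacobi functions of modulus $k\in(0,1)$): on $N_1$, $(k,\varphi,r)$ with $k=\sqrt{\frac{E+r}{2r}}$, $\sin\frac\beta2=k\,\mathrm{sn}(\sqrt r\varphi)$, $\frac c2=k\sqrt r\,\mathrm{cn}(\sqrt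 r\varphi)$, $\cos\frac\beta2=\mathrm{dn}(\sqrt r\varphi)$; on $N_2$, $(k,\psi,r)$ with $k=\sqrt{\frac{2r}{E+r}}$, $\sin\frac\beta2=\pm\mathrm{sn}(\sqrt r\psi)$, $\frac c2=\pm\frac{\sqrt r}{k}\mathrm{dn}(\sqrt r\psi)$, $\cos\frac\beta2=\mathrm{cn}(\sqrt r\psi)$, $\pm=\operatorname{sgn}c$; on $N_3$, $(\varphi,r)$ with $\sin\frac\beta2=\pm\tanh(\sqrt r\varphi)$, $\frac c2=\pm\frac{\sqrt r}{\cosh(\sqrt r\varphi)}$, $\cos\frac\beta2=\frac1{\cosh(\sqrt r\varphi)}$, $\pm=\operatorname{sgn}c$. Put $\tau=\frac{\sqrt r(\varphi+\varphi_t)}2$ with $\varphi_t=\varphi+t$ on $N_1$ and $N_3$, and $\tau=\frac{\sqrt r(\psi+\psi_t)}2$ with $\psi_t=\psi+\frac tk$ on $N_2$. Angles $\theta$ are understood modulo $2\pi$. **Theorem.** Let $t>0$. (1) Let $\nu\in N_1$ have elliptic coordinates $(k,\varphi,r)$. Then: - (1.1) $\nu\in\mathrm{MAX}^1_t\iff(\nu^1\ne\nu,\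 q^1_t=q_t)\iff\big(\mathrm{cn}\,\tau\ne0$ and $[\theta_t=0$ or $(x_t,y_t,\theta_t)=(0,0,\pi)]\big)$; - (1.2) $\nu\in\mathrm{MAX}^2_t\iff(\nu^2\ne\nu,\ q^2_t=q_t)\iff(\mathrm{sn}\,\tau\ne0,\ P_t=0)$; - (1.3) $\nu\in\mathrm{MAX}^3_t\iff(\nu^3\ne\nu,\ q^3_t=q_t)\iff(y_t=0,\ \theta_t\in\{0,\pi\})$. (2) Let $\nu\in N_2$ have elliptic coordinates $(k,\psi,r)$. Then: - (2.1) $\nu\in\mathrm{MAX}^1_t\iff(\nu^1\ne\nu,\ q^1_t=q_t)\iff\big(\theta_t=0$ or $(x_t,y_t,\theta_t)=(0,0,\pi)\big)$; - (2.2) $\nu\in\mathrm{MAX}^2_t\iff(\nu^2\ne\nu,\ q^2_t=q_t)\iff(\mathrm{sn}\,\tau\,\mathrm{cn}\,\tau\ne0,\ P_t=0)$; - (2.3) $\nu\in\mathrm{MAX}^3_t\iff(\nu^3\ne\nu,\ q^3_t=q_t)\iff(y_t=0,\ \theta_t\in\{0,\pi\})$. (3) Let $\nu\in N_3$ have elliptic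 coordinates $(\varphi,r)$. Then: - (3.1) $\nu\in\mathrm{MAX}^1_t\iff(\nu^1\ne\nu,\ q^1_t=q_t)\iff\theta_t=0$; - (3.2) $\nu\in\mathrm{MAX}^2_t\iff(\nu^2\ne\nu,\ q^2_t=q_t)\iff(\tau\ne0,\ P_t=0)$; - (3.3) $\nu\in\mathrm{MAX}^3_t\iff(\nu^3\ne\nu,\ q^3_t=q_t)\iff(y_t=0,\ \theta_t\in\{0,\pi\})$. (4) $\mathrm{MAX}^i_t\cap N_j=\emptyset$ for $i=1,2,3$ and $j=4,5,7$. (6) Let $\nu\in N_6$. Then: - (6.1) $\nu\in\mathrm{MAX}^1_t\iff(\nu^1\ne\nu,\ q^1_t=q_t)\iff\theta_t=0$; - (6.2) $\nu\notin\mathrm{MAX}^2_t$; - (6.3) $\nu\in\mathrm{MAX}^3_t\iff(\nu^3\ne\nu,\ q^3_t=q_t)\iff(y_t=0,\ \theta_t\in\{0,\pi\})$. -/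

import Mathlib

open Set Filter Topology MeasureTheory

noncomputable section

namespace Elastica

/-! ### Global solvability of ordinary differential equations -/

section ODE

variable {E : Type*} [NormedAddCommGroup E] [NormedSpace ℝ E]

lemma isMIntegralCurve_iff_forall_hasDerivAt (v : E → E) (γ : ℝ → E) :
    IsMIntegralCurve (I := modelWithCornersSelf ℝ E) γ v ↔
      ∀ t, HasDerivAt γ (v (γ t)) t := by
  refine ⟨fun h t => ?_, fun h t => ?_⟩
  · exact hasDerivAt_iff_hasFDerivAt.2
      ((hasMFDerivAt_iff_hasFDerivAt.1 (h t)).congr_fderiv (ContinuousLinearMap.ext fun _ => rfl))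
  · exact hasMFDerivAt_iff_hasFDerivAt.2
      ((hasDerivAt_iff_hasFDerivAt.1 (h t)).congr_fderiv (ContinuousLinearMap.ext fun _ => rfl))

lemma ode_global_unique [CompleteSpace E] {v : E → E} (hv : ContDiff ℝ 1 v) {f g : ℝ → E}
    (hf : ∀ t, HasDerivAt f (v (f t)) t) (hg : ∀ t, HasDerivAt g (v (g t)) t)
    (h0 : f 0 = g 0) : f = g :=
  isMIntegralCurve_Ioo_eq_of_contMDiff_boundaryless (I := modelWithCornersSelf ℝ E) (t₀ := 0)
    (v := v) (contMDiff_vectorSpace_iff_contDiff.2 hv)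
    ((isMIntegralCurve_iff_forall_hasDerivAt v f).2 hf)
    ((isMIntegralCurve_iff_forall_hasDerivAt v g).2 hg) h0

lemma ode_global_exists [CompleteSpace E] {v : E → E} (hv : ContDiff ℝ 1 v) {K : NNReal}
    (hK : LipschitzWith K v) (x : E) :
    ∃ γ : ℝ → E, γ 0 = x ∧ ∀ t, HasDerivAt γ (v (γ t)) t := by
  have key := exists_isMIntegralCurve_of_isMIntegralCurveOn (I := modelWithCornersSelf ℝ E)
    (v := v) (contMDiff_vectorSpace_iff_contDiff.2 hv) (ε := 1 / (K + 1))
    (by positivity) ?_ x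
  · obtain ⟨γ, h0, h⟩ := key
    exact ⟨γ, h0, (isMIntegralCurve_iff_forall_hasDerivAt v γ).1 h⟩
  · intro y
    set ε : ℝ := 1 / (K + 1) with hε
    have hεpos : 0 < ε := by positivity
    have h0mem : (0 : ℝ) ∈ Icc (-ε) ε := ⟨by linarith, hεpos.le⟩
    have hpl : IsPicardLindelof (fun _ : ℝ => v) (⟨0, h0mem⟩ : Icc (-ε) ε) y
        ‖v y‖₊ 0 (‖v y‖₊ + K * ‖v y‖₊) K :=
      { lipschitzOnWith := fun _ _ => hK.lipschitzOnWith
        continuousOn := fun _ _ => continuousOn_const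
        norm_le := by
          intro _ _ z hz
          have h1 : ‖v z - v y‖ ≤ K * ‖z - y‖ := by
            simpa [dist_eq_norm] using hK.dist_le_mul z y
          have h2 : ‖z - y‖ ≤ ‖v y‖ := by
            simpa [dist_eq_norm] using hz
          have h3 : ‖v z‖ ≤ ‖v y‖ + ‖v z - v y‖ := by
            simpa using norm_add_le (v y) (v z - v y)
          have h4 : (K : ℝ) * ‖z - y‖ ≤ K * ‖v y‖ :=
            mul_le_mul_of_nonneg_left h2 K.coe_nonneg
          push_cast
          linarith
        mul_max_le := by
          have : (K : ℝ) + 1 ≠ 0 := by positivity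
          simp only [sub_zero, zero_sub, neg_neg, max_self]
          push_cast
          simp only [hε]
          apply le_of_eq
          field_simp
          ring }
    obtain ⟨α, hα0, hα⟩ := hpl.exists_eq_forall_mem_Icc_hasDerivWithinAt₀
    refine ⟨α, hα0, fun t ht => ?_⟩
    have hd : HasDerivAt α (v (α t)) t :=
      (hα t (Ioo_subset_Icc_self ht)).hasDerivAt (Icc_mem_nhds ht.1 ht.2)
    exact (hasMFDerivAt_iff_hasFDerivAt.2 hd.hasFDerivAt).hasMFDerivWithinAt

end ODE

/-! ### Covectors, normal extremals, exponential mapping -/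

/-- The space `N` of covectors at the initial point `q₀ = (0, 0, 0)` of `M = ℝ² × S¹`. A covector
`ν` is given by its values `hᵢ = ⟨ν, Xᵢ⟩` on the basis `X₁ = cos θ ∂_x + sin θ ∂_y`, `X₂ = ∂_θ`,
`X₃ = sin θ ∂_x - cos θ ∂_y`. -/
@[ext]
structure Covector where
  h₁ : ℝ
  h₂ : ℝ
  h₃ : ℝ

/-- The state space `M = ℝ²_{x,y} × S¹_θ`. -/
@[ext]
structure Config where
  x : ℝ
  y : ℝ
  θ : Real.Angle

/-- A normal extremal of Euler's elastic problem starting over `q₀ = (0, 0, 0)`: a solution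
(for all times) of the Hamiltonian system of `H = h₁ + h₂² / 2` on `T*M`. The angle is lifted
to the real line, continuously and with `θ 0 = 0`. -/
@[ext]
structure NormalExtremal where
  h₁ : ℝ → ℝ
  h₂ : ℝ → ℝ
  h₃ : ℝ → ℝ
  x : ℝ → ℝ
  y : ℝ → ℝ
  θ : ℝ → ℝ
  deriv_h₁ : ∀ s, HasDerivAt h₁ (-(h₂ s * h₃ s)) s
  deriv_h₂ : ∀ s, HasDerivAt h₂ (h₃ s) s
  deriv_h₃ : ∀ s, HasDerivAt h₃ (h₁ s * h₂ s) s
  deriv_x : ∀ s, HasDerivAt x (Real.cos (θ s)) s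
  deriv_y : ∀ s, HasDerivAt y (Real.sin (θ s)) s
  deriv_θ : ∀ s, HasDerivAt θ (h₂ s) s
  x_zero : x 0 = 0
  y_zero : y 0 = 0
  θ_zero : θ 0 = 0

/-- The vertical part of an extremal at time `s`. -/
def NormalExtremal.vertical (e : NormalExtremal) (s : ℝ) : Covector :=
  ⟨e.h₁ s, e.h₂ s, e.h₃ s⟩

/-- The trajectory `q_s` of an extremal at time `s`. -/
def NormalExtremal.config (e : NormalExtremal) (s : ℝ) : Config :=
  ⟨e.x s, e.y s, (e.θ s : Real.Angle)⟩

namespace Covector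

/-- `r = √(h₁² + h₃²)`. -/
def r (ν : Covector) : ℝ := Real.sqrt (ν.h₁ ^ 2 + ν.h₃ ^ 2)

/-- `c = h₂`. -/
def c (ν : Covector) : ℝ := ν.h₂

/-- `β` is a value of the pendulum angle of `ν`: `h₁ = r cos (β - π)`, `h₃ = r sin (β - π)`.
It is unique modulo `2π` when `r ≠ 0`. -/
def IsAngle (ν : Covector) (β : ℝ) : Prop :=
  ν.h₁ = ν.r * Real.cos (β - Real.pi) ∧ ν.h₃ = ν.r * Real.sin (β - Real.pi)

/-- The energy `E = c² / 2 - r cos β` of the pendulum; here `-r cos β = h₁`. -/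
def energy (ν : Covector) : ℝ := ν.c ^ 2 / 2 + ν.h₁

lemma exists_isAngle (ν : Covector) : ∃ β, β ∈ Ioc (-Real.pi) Real.pi ∧ ν.IsAngle β := by
  have hr : ν.r = ‖(⟨-ν.h₁, -ν.h₃⟩ : ℂ)‖ := by
    rw [r, Complex.norm_def, Complex.normSq_apply]
    congr 1
    ring
  refine ⟨Complex.arg ⟨-ν.h₁, -ν.h₃⟩, Complex.arg_mem_Ioc _, ?_, ?_⟩
  · rw [Real.cos_sub_pi, hr, mul_neg, Complex.norm_mul_cos_arg]
    simp
  · rw [Real.sin_sub_pi, hr, mul_neg, Complex.norm_mul_sin_arg]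
    simp

lemma energy_eq (ν : Covector) {β : ℝ} (h : ν.IsAngle β) :
    ν.energy = ν.c ^ 2 / 2 - ν.r * Real.cos β := by
  rw [energy, h.1, Real.cos_sub_pi]
  ring

lemma exists_extremal (ν : Covector) : ∃ e : NormalExtremal, e.vertical 0 = ν := by
  obtain ⟨β₀, -, hβ₀⟩ := ν.exists_isAngle
  have hC : ContDiff ℝ 1 (fun p : ℝ × ℝ => (p.2, -(ν.r * Real.sin p.1))) := by fun_prop
  have hsin : LipschitzWith 1 Real.sin :=
    lipschitzWith_of_nnnorm_deriv_le Real.differentiable_sin (fun x => by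
      rw [← NNReal.coe_le_coe]
      simpa using Real.abs_cos_le_one x)
  have hL : LipschitzWith (max 1 (‖ν.r‖₊ * (1 * 1)))
      (fun p : ℝ × ℝ => (p.2, -(ν.r * Real.sin p.1))) :=
    LipschitzWith.prodMk LipschitzWith.prod_snd
      (((lipschitzWith_smul ν.r).comp (hsin.comp LipschitzWith.prod_fst)).neg)
  obtain ⟨γ, h0, hγ⟩ := ode_global_exists hC hL (β₀, ν.h₂)
  have hβ : ∀ t, HasDerivAt (fun s => (γ s).1) (γ t).2 t := fun t => (hγ t).fst
  have hc : ∀ t, HasDerivAt (fun s => (γ s).2) (-(ν.r * Real.sin (γ t).1)) t :=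
    fun t => (hγ t).snd
  have hβc : Continuous fun s => (γ s).1 :=
    continuous_iff_continuousAt.2 fun t => (hβ t).continuousAt
  refine ⟨{
    h₁ := fun s => -(ν.r * Real.cos (γ s).1)
    h₂ := fun s => (γ s).2
    h₃ := fun s => -(ν.r * Real.sin (γ s).1)
    x := fun s => ∫ u in (0 : ℝ)..s, Real.cos ((γ u).1 - β₀)
    y := fun s => ∫ u in (0 : ℝ)..s, Real.sin ((γ u).1 - β₀)
    θ := fun s => (γ s).1 - β₀
    deriv_h₁ := fun s => ?_
    deriv_h₂ := fun s => hc s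
    deriv_h₃ := fun s => ?_
    deriv_x := fun s => ?_
    deriv_y := fun s => ?_
    deriv_θ := fun s => (hβ s).sub_const β₀
    x_zero := by simp
    y_zero := by simp
    θ_zero := by simp [h0] }, ?_⟩
  · exact ((hβ s).cos.const_mul ν.r).neg.congr_deriv (by ring)
  · exact ((hβ s).sin.const_mul ν.r).neg.congr_deriv (by ring)
  · exact (by fun_prop : Continuous fun u => Real.cos ((γ u).1 - β₀)).integral_hasStrictDerivAt
      0 s |>.hasDerivAt
  · exact (by fun_prop : Continuous fun u => Real.sin ((γ u).1 - β₀)).integral_hasStrictDerivAt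
      0 s |>.hasDerivAt
  · have e1 := hβ₀.1
    have e3 := hβ₀.2
    rw [Real.cos_sub_pi] at e1
    rw [Real.sin_sub_pi] at e3
    ext
    · simp only [NormalExtremal.vertical, h0]; linarith
    · simp only [NormalExtremal.vertical, h0]
    · simp only [NormalExtremal.vertical, h0]; linarith

end Covector

/-- A normal extremal is determined by its initial covector. -/
lemma NormalExtremal.eq_of_vertical_zero_eq (e e' : NormalExtremal)
    (h : e.vertical 0 = e'.vertical 0) : e = e' := by
  let v : ℝ × ℝ × ℝ × ℝ × ℝ × ℝ → ℝ × ℝ × ℝ × ℝ × ℝ × ℝ := fun p =>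
    (-(p.2.1 * p.2.2.1), p.2.2.1, p.1 * p.2.1, Real.cos p.2.2.2.2.2, Real.sin p.2.2.2.2.2, p.2.1)
  have hv : ContDiff ℝ 1 v := by fun_prop
  have hsol : ∀ e : NormalExtremal, ∀ t, HasDerivAt
      (fun s => (e.h₁ s, e.h₂ s, e.h₃ s, e.x s, e.y s, e.θ s))
      (v (e.h₁ t, e.h₂ t, e.h₃ t, e.x t, e.y t, e.θ t)) t := fun e t =>
    (e.deriv_h₁ t).prodMk ((e.deriv_h₂ t).prodMk ((e.deriv_h₃ t).prodMk
      ((e.deriv_x t).prodMk ((e.deriv_y t).prodMk (e.deriv_θ t)))))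
  simp only [NormalExtremal.vertical, Covector.mk.injEq] at h
  have key := ode_global_unique hv (hsol e) (hsol e') (by
    simp only [e.x_zero, e.y_zero, e.θ_zero, e'.x_zero, e'.y_zero, e'.θ_zero, h.1, h.2.1, h.2.2])
  simp only [funext_iff, Prod.mk.injEq] at key
  ext s
  · exact (key s).1
  · exact (key s).2.1
  · exact (key s).2.2.1
  · exact (key s).2.2.2.1
  · exact (key s).2.2.2.2.1
  · exact (key s).2.2.2.2.2

theorem Covector.existsUnique_extremal (ν : Covector) :
    ∃! e : NormalExtremal, e.vertical 0 = ν := by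
  obtain ⟨e, he⟩ := ν.exists_extremal
  exact ⟨e, he, fun e' he' => NormalExtremal.eq_of_vertical_zero_eq e' e (he'.trans he.symm)⟩

/-- The normal extremal with initial covector `ν`. -/
def Covector.extremal (ν : Covector) : NormalExtremal :=
  Classical.choose ν.existsUnique_extremal

lemma Covector.extremal_vertical_zero (ν : Covector) : ν.extremal.vertical 0 = ν :=
  (Classical.choose_spec ν.existsUnique_extremal).1

/-- The exponential mapping `Exp_s : N → M`. -/
def Exp (s : ℝ) (ν : Covector) : Config := ν.extremal.config s

/-- The elastic energy `J_t = ½ ∫₀ᵗ u²`, with the extremal control `u = h₂`. -/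
def cost (t : ℝ) (ν : Covector) : ℝ := (1 / 2) * ∫ s in (0 : ℝ)..t, ν.extremal.h₂ s ^ 2

/-! ### Reflections and Maxwell strata -/

/-- Names of the three reflections. -/
inductive Reflection
  | ε₁
  | ε₂
  | ε₃

/-- The action of the reflections on `N` for the time `t`. In the pendulum coordinates it is
`(β, c) ↦ (β_t, -c_t)`, `(β, c) ↦ (-β_t, c_t)`, `(β, c) ↦ (-β, -c)` for `ε₁`, `ε₂`, `ε₃`
with `r` fixed; the change of sign of `β` is the change of sign of `h₃`. -/
def reflect (t : ℝ) : Reflection → Covector → Covector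
  | .ε₁, ν => ⟨ν.extremal.h₁ t, -ν.extremal.h₂ t, ν.extremal.h₃ t⟩
  | .ε₂, ν => ⟨ν.extremal.h₁ t, ν.extremal.h₂ t, -ν.extremal.h₃ t⟩
  | .ε₃, ν => ⟨ν.h₁, -ν.h₂, -ν.h₃⟩

/-- The Maxwell stratum `MAX^i_t` of the reflection `i`. -/
def MAX (i : Reflection) (t : ℝ) : Set Covector :=
  {ν | (∃ s ∈ Icc 0 t, Exp s (reflect t i ν) ≠ Exp s ν) ∧
    Exp t (reflect t i ν) = Exp t ν ∧ cost t ν = cost t (reflect t i ν)}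

/-- The function `P = x sin (θ / 2) - y cos (θ / 2)`. It is defined on `M` up to sign only; the
representative of `θ` in `(-π, π]` is used. -/
def Config.P (q : Config) : ℝ :=
  q.x * Real.sin (q.θ.toReal / 2) - q.y * Real.cos (q.θ.toReal / 2)

/-! ### The decomposition of `N` -/

def N₁ : Set Covector := {ν | ν.r ≠ 0 ∧ ν.energy ∈ Ioo (-ν.r) ν.r}
def N₂ : Set Covector := {ν | ν.r ≠ 0 ∧ ν.energy ∈ Ioi ν.r}
def N₃ : Set Covector := {ν | ν.r ≠ 0 ∧ ν.energy = ν.r ∧ ¬ ν.IsAngle Real.pi}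
def N₄ : Set Covector := {ν | ν.r ≠ 0 ∧ ν.energy = -ν.r}
def N₅ : Set Covector := {ν | ν.r ≠ 0 ∧ ν.energy = ν.r ∧ ν.IsAngle Real.pi}
def N₆ : Set Covector := {ν | ν.r = 0 ∧ ν.c ≠ 0}
def N₇ : Set Covector := {ν | ν.r = 0 ∧ ν.c = 0}

/-! ### Jacobi's elliptic functions -/

/-- The elliptic integral of the first kind, `F(φ, k)`. -/
def ellipticF (φ k : ℝ) : ℝ := ∫ t in (0 : ℝ)..φ, 1 / Real.sqrt (1 - k ^ 2 * Real.sin t ^ 2)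

/-- Jacobi's amplitude: the inverse of `F(·, k)`, for `k ∈ (0, 1)`. -/
def am (u k : ℝ) : ℝ := Function.invFun (fun φ => ellipticF φ k) u

def sn (u k : ℝ) : ℝ := Real.sin (am u k)
def cn (u k : ℝ) : ℝ := Real.cos (am u k)
def dn (u k : ℝ) : ℝ := Real.sqrt (1 - k ^ 2 * sn u k ^ 2)

lemma one_sub_pos {k : ℝ} (hk : k ∈ Ioo (0 : ℝ) 1) (t : ℝ) :
    0 < 1 - k ^ 2 * Real.sin t ^ 2 := by
  have h1 : k ^ 2 < 1 := by nlinarith [hk.1, hk.2]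
  have h2 := Real.sin_sq_le_one t
  nlinarith [sq_nonneg k, sq_nonneg (Real.sin t)]

lemma ellipticF_strictMono {k : ℝ} (hk : k ∈ Ioo (0 : ℝ) 1) :
    StrictMono fun φ => ellipticF φ k := by
  have hc : Continuous fun t : ℝ => 1 / Real.sqrt (1 - k ^ 2 * Real.sin t ^ 2) :=
    continuous_const.div (by fun_prop) fun t => (Real.sqrt_pos.2 (one_sub_pos hk t)).ne'
  intro a b hab
  have h := intervalIntegral.integral_add_adjacent_intervals
    (hc.intervalIntegrable (μ := volume) 0 a) (hc.intervalIntegrable a b)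
  have hp : 0 < ∫ t in a..b, 1 / Real.sqrt (1 - k ^ 2 * Real.sin t ^ 2) :=
    intervalIntegral.intervalIntegral_pos_of_pos (hc.intervalIntegrable a b)
      (fun t => one_div_pos.2 (Real.sqrt_pos.2 (one_sub_pos hk t))) hab
  simp only [ellipticF]
  linarith

lemma am_ellipticF {k : ℝ} (hk : k ∈ Ioo (0 : ℝ) 1) (φ : ℝ) : am (ellipticF φ k) k = φ :=
  Function.leftInverse_invFun (ellipticF_strictMono hk).injective φ

/-! ### Elliptic coordinates -/

/-- `(k, φ, r)`, with `r = ν.r`, are elliptic coordinates of `ν ∈ N₁`. -/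
def IsEllipticCoord₁ (ν : Covector) (k φ : ℝ) : Prop :=
  k = Real.sqrt ((ν.energy + ν.r) / (2 * ν.r)) ∧ ∃ β, ν.IsAngle β ∧
    Real.sin (β / 2) = k * sn (Real.sqrt ν.r * φ) k ∧
    ν.c / 2 = k * Real.sqrt ν.r * cn (Real.sqrt ν.r * φ) k ∧
    Real.cos (β / 2) = dn (Real.sqrt ν.r * φ) k

/-- `(k, ψ, r)`, with `r = ν.r`, are elliptic coordinates of `ν ∈ N₂`. -/
def IsEllipticCoord₂ (ν : Covector) (k ψ : ℝ) : Prop :=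
  k = Real.sqrt (2 * ν.r / (ν.energy + ν.r)) ∧ ∃ β, ν.IsAngle β ∧
    Real.sin (β / 2) = Real.sign ν.c * sn (Real.sqrt ν.r * ψ) k ∧
    ν.c / 2 = Real.sign ν.c * (Real.sqrt ν.r / k) * dn (Real.sqrt ν.r * ψ) k ∧
    Real.cos (β / 2) = cn (Real.sqrt ν.r * ψ) k

/-- `(φ, r)`, with `r = ν.r`, are elliptic coordinates of `ν ∈ N₃`. -/
def IsEllipticCoord₃ (ν : Covector) (φ : ℝ) : Prop :=
  ∃ β, ν.IsAngle β ∧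
    Real.sin (β / 2) = Real.sign ν.c * Real.tanh (Real.sqrt ν.r * φ) ∧
    ν.c / 2 = Real.sign ν.c * (Real.sqrt ν.r / Real.cosh (Real.sqrt ν.r * φ)) ∧
    Real.cos (β / 2) = 1 / Real.cosh (Real.sqrt ν.r * φ)

/-- `τ = √r (φ + φ_t) / 2` for `ν ∈ N₁ ∪ N₃`, where `φ_t = φ + t`. -/
def tau (ν : Covector) (φ t : ℝ) : ℝ := Real.sqrt ν.r * (φ + (φ + t)) / 2

/-- `τ = √r (ψ + ψ_t) / 2` for `ν ∈ N₂`, where `ψ_t = φ_t / k = ψ + t / k`. -/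
def tau₂ (ν : Covector) (k ψ t : ℝ) : ℝ := Real.sqrt ν.r * (ψ + (ψ + t / k)) / 2

lemma Covector.r_nonneg (ν : Covector) : 0 ≤ ν.r := Real.sqrt_nonneg _

lemma Covector.sin_half_sq (ν : Covector) {β : ℝ} (h : ν.IsAngle β) :
    2 * ν.r * Real.sin (β / 2) ^ 2 = ν.energy + ν.r - ν.c ^ 2 / 2 := by
  have h1 : Real.cos β = 1 - 2 * Real.sin (β / 2) ^ 2 := by
    have := Real.cos_two_mul' (β / 2)
    rw [show 2 * (β / 2) = β by ring] at this
    linarith [Real.sin_sq_add_cos_sq (β / 2)]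
  rw [ν.energy_eq h, h1]
  ring

lemma exists_cos_sin {C S : ℝ} (h : C ^ 2 + S ^ 2 = 1) :
    ∃ a, Real.cos a = C ∧ Real.sin a = S := by
  have hn : ‖(⟨C, S⟩ : ℂ)‖ = 1 := by
    rw [Complex.norm_def, Complex.normSq_apply, ← h.symm.trans (by ring : _ = C * C + S * S)]
    simp
  refine ⟨Complex.arg ⟨C, S⟩, ?_, ?_⟩
  · simpa [hn] using Complex.norm_mul_cos_arg ⟨C, S⟩
  · simpa [hn] using Complex.norm_mul_sin_arg ⟨C, S⟩

/-- Every point of `N₁` has elliptic coordinates. -/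
theorem exists_ellipticCoord₁ {ν : Covector} (h : ν ∈ N₁) : ∃ k φ, IsEllipticCoord₁ ν k φ := by
  obtain ⟨hr0, hE⟩ := h
  have hr : 0 < ν.r := lt_of_le_of_ne ν.r_nonneg (Ne.symm hr0)
  obtain ⟨β, hβm, hβ⟩ := ν.exists_isAngle
  have hs := ν.sin_half_sq hβ
  set k := Real.sqrt ((ν.energy + ν.r) / (2 * ν.r)) with hkdef
  have hkpos : 0 < (ν.energy + ν.r) / (2 * ν.r) := div_pos (by linarith [hE.1]) (by linarith)
  have hk2 : k ^ 2 = (ν.energy + ν.r) / (2 * ν.r) := Real.sq_sqrt hkpos.le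
  have hk0 : 0 < k := Real.sqrt_pos.2 hkpos
  have hk2' : k ^ 2 * (2 * ν.r) = ν.energy + ν.r := by
    rw [hk2]; field_simp
  have hk1 : k < 1 := by
    have : k ^ 2 < 1 := by nlinarith [hE.2]
    nlinarith
  have hsr : 0 < Real.sqrt ν.r := Real.sqrt_pos.2 hr
  have hsr2 : Real.sqrt ν.r ^ 2 = ν.r := Real.sq_sqrt hr.le
  obtain ⟨a, hca, hsa⟩ := exists_cos_sin
    (C := ν.c / (2 * k * Real.sqrt ν.r)) (S := Real.sin (β / 2) / k) (by
      rw [div_pow, div_pow, mul_pow, mul_pow, hsr2]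
      field_simp
      nlinarith)
  have hu : Real.sqrt ν.r * (ellipticF a k / Real.sqrt ν.r) = ellipticF a k := by
    field_simp
  refine ⟨k, ellipticF a k / Real.sqrt ν.r, hkdef, β, hβ, ?_, ?_, ?_⟩
  · rw [hu, sn, am_ellipticF ⟨hk0, hk1⟩, hsa]
    field_simp
  · rw [hu, cn, am_ellipticF ⟨hk0, hk1⟩, hca]
    field_simp
  · rw [hu, dn, sn, am_ellipticF ⟨hk0, hk1⟩, hsa, div_pow, mul_div_cancel₀ _ (by positivity),
      ← Real.cos_sq', Real.sqrt_sq]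
    exact Real.cos_nonneg_of_mem_Icc ⟨by linarith [hβm.1], by linarith [hβm.2]⟩

/-- Every point of `N₂` has elliptic coordinates. -/
theorem exists_ellipticCoord₂ {ν : Covector} (h : ν ∈ N₂) : ∃ k ψ, IsEllipticCoord₂ ν k ψ := by
  obtain ⟨hr0, hE⟩ := h
  have hr : 0 < ν.r := lt_of_le_of_ne ν.r_nonneg (Ne.symm hr0)
  rw [mem_Ioi] at hE
  obtain ⟨β, hβm, hβ⟩ := ν.exists_isAngle
  have hs := ν.sin_half_sq hβ
  have hc0 : ν.c ≠ 0 := by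
    intro h0
    rw [h0] at hs
    nlinarith [Real.sin_sq_le_one (β / 2)]
  set k := Real.sqrt (2 * ν.r / (ν.energy + ν.r)) with hkdef
  have hkpos : 0 < 2 * ν.r / (ν.energy + ν.r) := div_pos (by linarith) (by linarith)
  have hk2 : k ^ 2 = 2 * ν.r / (ν.energy + ν.r) := Real.sq_sqrt hkpos.le
  have hk0 : 0 < k := Real.sqrt_pos.2 hkpos
  have hk2' : k ^ 2 * (ν.energy + ν.r) = 2 * ν.r := by
    rw [hk2]
    exact div_mul_cancel₀ _ (by linarith)
  have hk1 : k < 1 := by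
    by_contra hcon
    have : 1 ≤ k ^ 2 := by nlinarith
    nlinarith
  have hsr : 0 < Real.sqrt ν.r := Real.sqrt_pos.2 hr
  have hsr2 : Real.sqrt ν.r ^ 2 = ν.r := Real.sq_sqrt hr.le
  have hσ : Real.sign ν.c = 1 ∨ Real.sign ν.c = -1 := by
    rcases lt_or_gt_of_ne hc0 with h | h
    · exact Or.inr (Real.sign_of_neg h)
    · exact Or.inl (Real.sign_of_pos h)
  have hσc : Real.sign ν.c * |ν.c| = ν.c := by
    rcases lt_or_gt_of_ne hc0 with h | h
    · rw [Real.sign_of_neg h, abs_of_neg h]; ring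
    · rw [Real.sign_of_pos h, abs_of_pos h]; ring
  obtain ⟨a, hca, hsa⟩ := exists_cos_sin
    (C := Real.cos (β / 2)) (S := Real.sign ν.c * Real.sin (β / 2)) (by
      rcases hσ with h | h <;> rw [h] <;> nlinarith [Real.sin_sq_add_cos_sq (β / 2)])
  have hu : Real.sqrt ν.r * (ellipticF a k / Real.sqrt ν.r) = ellipticF a k := by
    field_simp
  refine ⟨k, ellipticF a k / Real.sqrt ν.r, hkdef, β, hβ, ?_, ?_, ?_⟩
  · rw [hu, sn, am_ellipticF ⟨hk0, hk1⟩, hsa]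
    rcases hσ with h | h <;> rw [h] <;> ring
  · have hd : dn (ellipticF a k) k = k * |ν.c| / (2 * Real.sqrt ν.r) := by
      rw [dn, sn, am_ellipticF ⟨hk0, hk1⟩, hsa, ← Real.sqrt_sq
        (by positivity : 0 ≤ k * |ν.c| / (2 * Real.sqrt ν.r))]
      congr 1
      have hσ2 : Real.sign ν.c ^ 2 = 1 := by rcases hσ with h | h <;> rw [h] <;> norm_num
      rw [div_pow, mul_pow, mul_pow, mul_pow, hsr2, hσ2, sq_abs]
      field_simp
      nlinarith
    rw [hu, hd]
    calc ν.c / 2 = Real.sign ν.c * |ν.c| / 2 := by rw [hσc]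
      _ = _ := by field_simp
  · rw [hu, cn, am_ellipticF ⟨hk0, hk1⟩, hca]

/-- Every point of `N₃` has elliptic coordinates. -/
theorem exists_ellipticCoord₃ {ν : Covector} (h : ν ∈ N₃) : ∃ φ, IsEllipticCoord₃ ν φ := by
  obtain ⟨hr0, hE, hπ⟩ := h
  have hr : 0 < ν.r := lt_of_le_of_ne ν.r_nonneg (Ne.symm hr0)
  obtain ⟨β, hβm, hβ⟩ := ν.exists_isAngle
  have hs := ν.sin_half_sq hβ
  have hβlt : β < Real.pi := lt_of_le_of_ne hβm.2 (by rintro rfl; exact hπ hβ)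
  have hcos : 0 < Real.cos (β / 2) :=
    Real.cos_pos_of_mem_Ioo ⟨by linarith [hβm.1], by linarith⟩
  have hsr : 0 < Real.sqrt ν.r := Real.sqrt_pos.2 hr
  have hsr2 : Real.sqrt ν.r ^ 2 = ν.r := Real.sq_sqrt hr.le
  have hsc := Real.sin_sq_add_cos_sq (β / 2)
  have hc2 : ν.c ^ 2 = (2 * Real.sqrt ν.r * Real.cos (β / 2)) ^ 2 := by
    rw [mul_pow, mul_pow, hsr2]
    nlinarith
  have habs : |ν.c| = 2 * Real.sqrt ν.r * Real.cos (β / 2) := by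
    rw [← abs_of_pos (by positivity : 0 < 2 * Real.sqrt ν.r * Real.cos (β / 2))]
    exact sq_eq_sq_iff_abs_eq_abs _ _ |>.1 hc2
  have hc0 : ν.c ≠ 0 := by
    rw [← abs_pos, habs]; positivity
  have hσ : Real.sign ν.c = 1 ∨ Real.sign ν.c = -1 := by
    rcases lt_or_gt_of_ne hc0 with h | h
    · exact Or.inr (Real.sign_of_neg h)
    · exact Or.inl (Real.sign_of_pos h)
  have hσc : Real.sign ν.c * |ν.c| = ν.c := by
    rcases lt_or_gt_of_ne hc0 with h | h
    · rw [Real.sign_of_neg h, abs_of_neg h]; ring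
    · rw [Real.sign_of_pos h, abs_of_pos h]; ring
  set w := Real.arsinh (Real.sign ν.c * Real.sin (β / 2) / Real.cos (β / 2)) with hw
  have hsinh : Real.sinh w = Real.sign ν.c * Real.sin (β / 2) / Real.cos (β / 2) :=
    Real.sinh_arsinh _
  have hσ2 : Real.sign ν.c ^ 2 = 1 := by rcases hσ with h | h <;> rw [h] <;> norm_num
  have hcosh : Real.cosh w = 1 / Real.cos (β / 2) := by
    have h1 : Real.cosh w ^ 2 = (1 / Real.cos (β / 2)) ^ 2 := by
      rw [Real.cosh_sq, hsinh, div_pow, mul_pow, hσ2]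
      field_simp
      linarith
    exact (sq_eq_sq₀ (Real.cosh_pos w).le (by positivity)).1 h1
  have hu : Real.sqrt ν.r * (w / Real.sqrt ν.r) = w := by field_simp
  refine ⟨w / Real.sqrt ν.r, β, hβ, ?_, ?_, ?_⟩
  · rw [hu, Real.tanh_eq_sinh_div_cosh, hsinh, hcosh]
    field_simp
    rw [hσ2, mul_one]
  · rw [hu, hcosh]
    calc ν.c / 2 = Real.sign ν.c * |ν.c| / 2 := by rw [hσc]
      _ = _ := by rw [habs]; field_simp
  · rw [hu, hcosh]
    field_simp

end Elastica

end

open Elastica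

/-!
The reflections act on whole extremals, not only on initial covectors. The first one reverses
time and moves the elastica back to the origin by a rigid motion (`NormalExtremal.reverse`), the
third one is the mirror image in the `x`-axis (`NormalExtremal.mirror`), and the second one is
their composition. Three facts about an arbitrary covector follow.

* The control changes at most by sign and by time reversal, so the costs always agree. The energy
  is preserved too, and a covector is determined by its energy and its trajectory on `[0, t]`
  (`eq_of_Exp_eq`). Hence `ν ∈ MAX^i_t` means exactly that `ν^i ≠ ν` and `q^i_t = q_t`
  (`mem_MAX_iff`).
* With the planar position written as a complex number `z`, the reflected end points are
  `(e^{-iθ} z, -θ)`, `(e^{iθ} z̄, θ)` and `(z̄, -θ)`. Comparing them with `(z, θ)` gives the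
  conditions `θ = 0 ∨ (z, θ) = (0, π)`, then `P = 0`, and finally `y = 0 ∧ θ ∈ {0, π}`
  (`Exp_reflect₁_eq_iff`, `Exp_reflect₂_eq_iff`, `Exp_reflect₃_eq_iff`).
* `ν^i = ν` is a relation between the vertical parts at the times `0` and `t`.

On `N₁`, `N₂`, `N₃` the vertical part is an explicit function of the elliptic coordinates; this
needs the differential equation `am' = dn`. The relation `ν^i = ν` then compares the amplitude at
two arguments `u` and `v`. As `am u + am v = nπ` if and only if `am ((u + v) / 2) = nπ / 2`
(`am_add_am_eq_iff`), it becomes a condition on Jacobi's functions at the midpoint `τ`.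
The rotating and the separatrix motions of the pendulum keep the sign of `c`, so there `ν¹ ≠ ν`.
On `N₄`, `N₅`, `N₇` every reflection fixes `ν`.

The end point `(0, 0, π)` has to be excluded on `N₃` and on `N₆`. On `N₆` the trajectory is a
circle. For `N₃` see `IsEllipticCoord₃.Exp_ne`.
-/

namespace Elastica

/-! ### Reflected extremals -/

lemma extremal_eq {ν : Covector} {e : NormalExtremal} (h : e.vertical 0 = ν) : ν.extremal = e :=
  NormalExtremal.eq_of_vertical_zero_eq _ _ (ν.extremal_vertical_zero.trans h.symm)

lemma extremal_h₁_zero (ν : Covector) : ν.extremal.h₁ 0 = ν.h₁ :=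
  congrArg Covector.h₁ ν.extremal_vertical_zero

lemma extremal_h₂_zero (ν : Covector) : ν.extremal.h₂ 0 = ν.h₂ :=
  congrArg Covector.h₂ ν.extremal_vertical_zero

lemma extremal_h₃_zero (ν : Covector) : ν.extremal.h₃ 0 = ν.h₃ :=
  congrArg Covector.h₃ ν.extremal_vertical_zero

/-- The elastica run backwards from time `t`, moved by the rigid motion that puts its new starting
point at the origin and its new initial velocity along the positive `x`-axis. -/
noncomputable def NormalExtremal.reverse (e : NormalExtremal) (t : ℝ) : NormalExtremal where
  h₁ s := e.h₁ (t - s)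
  h₂ s := -e.h₂ (t - s)
  h₃ s := e.h₃ (t - s)
  x s := Real.cos (e.θ t) * (e.x t - e.x (t - s)) + Real.sin (e.θ t) * (e.y t - e.y (t - s))
  y s := Real.cos (e.θ t) * (e.y t - e.y (t - s)) - Real.sin (e.θ t) * (e.x t - e.x (t - s))
  θ s := e.θ (t - s) - e.θ t
  deriv_h₁ s := ((e.deriv_h₁ (t - s)).comp_const_sub t s).congr_deriv (by ring)
  deriv_h₂ s := ((e.deriv_h₂ (t - s)).comp_const_sub t s).neg.congr_deriv (by ring)
  deriv_h₃ s := ((e.deriv_h₃ (t - s)).comp_const_sub t s).congr_deriv (by ring)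
  deriv_x s := by
    have hx := ((e.deriv_x (t - s)).comp_const_sub t s).const_sub (e.x t)
    have hy := ((e.deriv_y (t - s)).comp_const_sub t s).const_sub (e.y t)
    refine ((hx.const_mul (Real.cos (e.θ t))).add
      (hy.const_mul (Real.sin (e.θ t)))).congr_deriv ?_
    rw [Real.cos_sub]
    ring
  deriv_y s := by
    have hx := ((e.deriv_x (t - s)).comp_const_sub t s).const_sub (e.x t)
    have hy := ((e.deriv_y (t - s)).comp_const_sub t s).const_sub (e.y t)
    refine ((hy.const_mul (Real.cos (e.θ t))).sub
      (hx.const_mul (Real.sin (e.θ t)))).congr_deriv ?_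
    rw [Real.sin_sub]
    ring
  deriv_θ s := (((e.deriv_θ (t - s)).comp_const_sub t s).sub_const (e.θ t)).congr_deriv (by ring)
  x_zero := by simp
  y_zero := by simp
  θ_zero := by simp

/-- The mirror image of an elastica in the `x`-axis. -/
def NormalExtremal.mirror (e : NormalExtremal) : NormalExtremal where
  h₁ := e.h₁
  h₂ s := -e.h₂ s
  h₃ s := -e.h₃ s
  x := e.x
  y s := -e.y s
  θ s := -e.θ s
  deriv_h₁ s := (e.deriv_h₁ s).congr_deriv (by ring)
  deriv_h₂ s := (e.deriv_h₂ s).neg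
  deriv_h₃ s := (e.deriv_h₃ s).neg.congr_deriv (by ring)
  deriv_x s := (e.deriv_x s).congr_deriv (by rw [Real.cos_neg])
  deriv_y s := (e.deriv_y s).neg.congr_deriv (by rw [Real.sin_neg])
  deriv_θ s := (e.deriv_θ s).neg
  x_zero := e.x_zero
  y_zero := by simp [e.y_zero]
  θ_zero := by simp [e.θ_zero]

lemma extremal_reflect₁ (t : ℝ) (ν : Covector) :
    (reflect t .ε₁ ν).extremal = ν.extremal.reverse t :=
  extremal_eq (by simp [NormalExtremal.vertical, NormalExtremal.reverse, reflect])

lemma extremal_reflect₂ (t : ℝ) (ν : Covector) :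
    (reflect t .ε₂ ν).extremal = (ν.extremal.reverse t).mirror :=
  extremal_eq (by
    simp [NormalExtremal.vertical, NormalExtremal.reverse, NormalExtremal.mirror, reflect])

lemma extremal_reflect₃ (t : ℝ) (ν : Covector) :
    (reflect t .ε₃ ν).extremal = ν.extremal.mirror :=
  extremal_eq (by
    simp [NormalExtremal.vertical, NormalExtremal.mirror, reflect, extremal_h₁_zero,
      extremal_h₂_zero, extremal_h₃_zero])

lemma cost_reflect (i : Reflection) (t : ℝ) (ν : Covector) :
    cost t (reflect t i ν) = cost t ν := by
  have hrev := intervalIntegral.integral_comp_sub_left (a := 0) (b := t)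
    (fun s => ν.extremal.h₂ s ^ 2) t
  rw [sub_self, sub_zero] at hrev
  cases i
  · simp only [cost, extremal_reflect₁, NormalExtremal.reverse, neg_sq, hrev]
  · simp only [cost, extremal_reflect₂, NormalExtremal.mirror, NormalExtremal.reverse, neg_neg,
      hrev]
  · simp only [cost, extremal_reflect₃, NormalExtremal.mirror, neg_sq]

/-! ### First integrals -/

lemma extremal_energy (ν : Covector) (s : ℝ) :
    ν.extremal.h₂ s ^ 2 / 2 + ν.extremal.h₁ s = ν.energy := by
  have hd : ∀ u, HasDerivAt (fun u => ν.extremal.h₂ u ^ 2 / 2 + ν.extremal.h₁ u) 0 u := fun u =>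
    ((((ν.extremal.deriv_h₂ u).pow 2).div_const 2).add (ν.extremal.deriv_h₁ u)).congr_deriv
      (by simp; ring)
  have h := is_const_of_deriv_eq_zero (fun u => (hd u).differentiableAt) (fun u => (hd u).deriv) s 0
  simp only [extremal_h₁_zero, extremal_h₂_zero] at h
  exact h

lemma energy_reflect (i : Reflection) (t : ℝ) (ν : Covector) :
    (reflect t i ν).energy = ν.energy := by
  cases i
  · simpa [reflect, Covector.energy, Covector.c] using extremal_energy ν t
  · simpa [reflect, Covector.energy, Covector.c] using extremal_energy ν t
  · simp [reflect, Covector.energy, Covector.c]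

/-- The planar vector `h₁ X₁ + h₃ X₃`, with Cartesian components
`(h₁ cos θ + h₃ sin θ, h₁ sin θ - h₃ cos θ)`, is constant along an elastica. -/
lemma extremal_force (ν : Covector) (s : ℝ) :
    ν.extremal.h₁ s * Real.cos (ν.extremal.θ s) + ν.extremal.h₃ s * Real.sin (ν.extremal.θ s)
        = ν.h₁ ∧
      ν.extremal.h₁ s * Real.sin (ν.extremal.θ s) - ν.extremal.h₃ s * Real.cos (ν.extremal.θ s)
        = -ν.h₃ := by
  set e := ν.extremal with he
  have hd₁ : ∀ u, HasDerivAt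
      (fun u => e.h₁ u * Real.cos (e.θ u) + e.h₃ u * Real.sin (e.θ u)) 0 u := fun u =>
    (((e.deriv_h₁ u).mul (e.deriv_θ u).cos).add
      ((e.deriv_h₃ u).mul (e.deriv_θ u).sin)).congr_deriv (by ring)
  have hd₂ : ∀ u, HasDerivAt
      (fun u => e.h₁ u * Real.sin (e.θ u) - e.h₃ u * Real.cos (e.θ u)) 0 u := fun u =>
    (((e.deriv_h₁ u).mul (e.deriv_θ u).sin).sub
      ((e.deriv_h₃ u).mul (e.deriv_θ u).cos)).congr_deriv (by ring)
  have h₁ := is_const_of_deriv_eq_zero (fun u => (hd₁ u).differentiableAt)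
    (fun u => (hd₁ u).deriv) s 0
  have h₂ := is_const_of_deriv_eq_zero (fun u => (hd₂ u).differentiableAt)
    (fun u => (hd₂ u).deriv) s 0
  have hθ : ν.extremal.θ 0 = 0 := ν.extremal.θ_zero
  simp only [he, hθ, extremal_h₁_zero, extremal_h₃_zero, Real.cos_zero, Real.sin_zero,
    mul_one, mul_zero, add_zero, zero_sub] at h₁ h₂
  exact ⟨h₁, h₂⟩

/-! ### Maxwell strata and fixed points of the reflections -/

/-- Covectors of equal energy whose trajectories agree on `[0, t]` are equal: the trajectory
determines `h₂ = θ'` and `h₃ = h₂'` on `(0, t)`, and the energy then determines `h₁`. -/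
lemma eq_of_Exp_eq {ν μ : Covector} {t : ℝ} (ht : 0 < t) (hE : μ.energy = ν.energy)
    (h : ∀ s ∈ Icc 0 t, Exp s μ = Exp s ν) : μ = ν := by
  have hev : ∀ s ∈ Ioo 0 t, ∀ᶠ u in 𝓝 s, u ∈ Ioo 0 t := fun s hs => isOpen_Ioo.mem_nhds hs
  have hθ : ∀ s ∈ Ioo 0 t, (μ.extremal.θ s : Real.Angle) = ν.extremal.θ s := fun s hs =>
    congrArg Config.θ (h s (Ioo_subset_Icc_self hs))
  have hcos : ∀ s ∈ Ioo 0 t, Real.cos (μ.extremal.θ s) = Real.cos (ν.extremal.θ s) :=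
    fun s hs => by simpa using congrArg Real.Angle.cos (hθ s hs)
  have hsin : ∀ s ∈ Ioo 0 t, Real.sin (μ.extremal.θ s) = Real.sin (ν.extremal.θ s) :=
    fun s hs => by simpa using congrArg Real.Angle.sin (hθ s hs)
  have h₂ : ∀ s ∈ Ioo 0 t, μ.extremal.h₂ s = ν.extremal.h₂ s := fun s hs => by
    have ec := (μ.extremal.deriv_θ s).cos.unique
      ((ν.extremal.deriv_θ s).cos.congr_of_eventuallyEq ((hev s hs).mono hcos))
    have es := (μ.extremal.deriv_θ s).sin.unique
      ((ν.extremal.deriv_θ s).sin.congr_of_eventuallyEq ((hev s hs).mono hsin))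
    rw [hsin s hs] at ec
    rw [hcos s hs] at es
    linear_combination Real.cos (ν.extremal.θ s) * es - Real.sin (ν.extremal.θ s) * ec +
      (ν.extremal.h₂ s - μ.extremal.h₂ s) * Real.sin_sq_add_cos_sq (ν.extremal.θ s)
  have h₃ : ∀ s ∈ Ioo 0 t, μ.extremal.h₃ s = ν.extremal.h₃ s := fun s hs =>
    (μ.extremal.deriv_h₂ s).unique
      ((ν.extremal.deriv_h₂ s).congr_of_eventuallyEq ((hev s hs).mono h₂))
  have h₁ : ∀ s ∈ Ioo 0 t, μ.extremal.h₁ s = ν.extremal.h₁ s := fun s hs => by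
    have e₁ := extremal_energy μ s
    have e₂ := extremal_energy ν s
    rw [h₂ s hs] at e₁
    linarith
  have hm : t / 2 ∈ Ioo 0 t := ⟨by linarith, by linarith⟩
  -- the force and the energy carry the equality at time `t / 2` back to the time `0`
  have fμ := extremal_force μ (t / 2)
  have fν := extremal_force ν (t / 2)
  rw [h₁ _ hm, h₃ _ hm, hcos _ hm, hsin _ hm] at fμ
  have e₁ : μ.h₁ = ν.h₁ := fμ.1.symm.trans fν.1
  have e₃ : μ.h₃ = ν.h₃ := neg_injective (fμ.2.symm.trans fν.2)
  have hc : Continuous fun s => μ.extremal.h₂ s - ν.extremal.h₂ s :=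
    continuous_iff_continuousAt.2 fun s =>
      ((μ.extremal.deriv_h₂ s).sub (ν.extremal.deriv_h₂ s)).continuousAt
  have hcl : closure (Ioo 0 t) ⊆ {s | μ.extremal.h₂ s - ν.extremal.h₂ s = 0} :=
    closure_minimal (fun s hs => sub_eq_zero.2 (h₂ s hs)) (isClosed_eq hc continuous_const)
  rw [closure_Ioo ht.ne] at hcl
  have e₂ : μ.extremal.h₂ 0 = ν.extremal.h₂ 0 := sub_eq_zero.1 (hcl (left_mem_Icc.2 ht.le))
  rw [extremal_h₂_zero, extremal_h₂_zero] at e₂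
  exact Covector.ext e₁ e₂ e₃

theorem mem_MAX_iff (i : Reflection) {t : ℝ} (ht : 0 < t) (ν : Covector) :
    ν ∈ MAX i t ↔ reflect t i ν ≠ ν ∧ Exp t (reflect t i ν) = Exp t ν := by
  constructor
  · rintro ⟨⟨s, -, hs⟩, h, -⟩
    exact ⟨fun h' => hs (by rw [h']), h⟩
  · rintro ⟨hne, h⟩
    refine ⟨?_, h, (cost_reflect i t ν).symm⟩
    by_contra! hcon
    exact hne (eq_of_Exp_eq ht (energy_reflect i t ν) hcon)

/-! ### The end points of reflected trajectories -/

lemma Exp_reflect₁ (t : ℝ) (ν : Covector) : Exp t (reflect t .ε₁ ν) =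
    ⟨(Exp t ν).θ.cos * (Exp t ν).x + (Exp t ν).θ.sin * (Exp t ν).y,
      (Exp t ν).θ.cos * (Exp t ν).y - (Exp t ν).θ.sin * (Exp t ν).x, -(Exp t ν).θ⟩ := by
  simp [Exp, extremal_reflect₁, NormalExtremal.config, NormalExtremal.reverse,
    ν.extremal.x_zero, ν.extremal.y_zero, ν.extremal.θ_zero]

lemma Exp_reflect₂ (t : ℝ) (ν : Covector) : Exp t (reflect t .ε₂ ν) =
    ⟨(Exp t ν).θ.cos * (Exp t ν).x + (Exp t ν).θ.sin * (Exp t ν).y,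
      (Exp t ν).θ.sin * (Exp t ν).x - (Exp t ν).θ.cos * (Exp t ν).y, (Exp t ν).θ⟩ := by
  simp [Exp, extremal_reflect₂, NormalExtremal.config, NormalExtremal.reverse,
    NormalExtremal.mirror, ν.extremal.x_zero, ν.extremal.y_zero, ν.extremal.θ_zero]

lemma Exp_reflect₃ (t : ℝ) (ν : Covector) : Exp t (reflect t .ε₃ ν) =
    ⟨(Exp t ν).x, -(Exp t ν).y, -(Exp t ν).θ⟩ := by
  simp [Exp, extremal_reflect₃, NormalExtremal.config, NormalExtremal.mirror]

lemma Exp_reflect₁_eq_iff (t : ℝ) (ν : Covector) : Exp t (reflect t .ε₁ ν) = Exp t ν ↔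
    (Exp t ν).θ = 0 ∨ Exp t ν = ⟨0, 0, (Real.pi : Real.Angle)⟩ := by
  rw [Exp_reflect₁]
  generalize Exp t ν = q
  simp only [Config.ext_iff, Real.Angle.neg_eq_self_iff]
  constructor
  · rintro ⟨hx, hy, h | h⟩
    · exact Or.inl h
    · rw [h, Real.Angle.cos_coe_pi, Real.Angle.sin_coe, Real.sin_pi] at hx hy
      exact Or.inr ⟨by linarith, by linarith, h⟩
  · rintro (h | ⟨hx, hy, h⟩)
    · simp [h]
    · simp [hx, hy, h]

lemma Exp_reflect₂_eq_iff (t : ℝ) (ν : Covector) :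
    Exp t (reflect t .ε₂ ν) = Exp t ν ↔ (Exp t ν).P = 0 := by
  rw [Exp_reflect₂]
  generalize Exp t ν = q
  have hc : q.θ.cos = 2 * Real.cos (q.θ.toReal / 2) ^ 2 - 1 := by
    rw [← Real.Angle.cos_toReal, ← Real.cos_two_mul]
    congr 1
    ring
  have hs : q.θ.sin = 2 * Real.sin (q.θ.toReal / 2) * Real.cos (q.θ.toReal / 2) := by
    rw [← Real.Angle.sin_toReal, ← Real.sin_two_mul]
    congr 1
    ring
  have h1 := Real.sin_sq_add_cos_sq (q.θ.toReal / 2)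
  simp only [Config.ext_iff, Config.P, hc, hs, and_true]
  set S := Real.sin (q.θ.toReal / 2)
  set C := Real.cos (q.θ.toReal / 2)
  constructor
  · rintro ⟨hx, hy⟩
    linear_combination (-(q.x * S - q.y * C)) * h1 - S / 2 * hx + C / 2 * hy + S * q.x * h1
  · intro h
    constructor
    · linear_combination (-2 * S) * h + 2 * q.x * h1
    · linear_combination (2 * C) * h

lemma Exp_reflect₃_eq_iff (t : ℝ) (ν : Covector) : Exp t (reflect t .ε₃ ν) = Exp t ν ↔
    (Exp t ν).y = 0 ∧ ((Exp t ν).θ = 0 ∨ (Exp t ν).θ = (Real.pi : Real.Angle)) := by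
  rw [Exp_reflect₃]
  generalize Exp t ν = q
  simp only [Config.ext_iff, Real.Angle.neg_eq_self_iff, neg_eq_self, true_and]

lemma reflect₃_eq_self_iff (t : ℝ) (ν : Covector) :
    reflect t .ε₃ ν = ν ↔ ν.h₂ = 0 ∧ ν.h₃ = 0 := by
  simp [reflect, Covector.ext_iff, neg_eq_self]

/-! ### Jacobi's functions as solutions of differential equations -/

section Jacobi

variable {k : ℝ}

lemma continuous_ellipticF_integrand (hk : k ∈ Ioo (0 : ℝ) 1) :
    Continuous fun t : ℝ => 1 / Real.sqrt (1 - k ^ 2 * Real.sin t ^ 2) :=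
  continuous_const.div (by fun_prop) fun t => (Real.sqrt_pos.2 (one_sub_pos hk t)).ne'

lemma hasDerivAt_ellipticF (hk : k ∈ Ioo (0 : ℝ) 1) (φ : ℝ) :
    HasDerivAt (fun φ => ellipticF φ k) (1 / Real.sqrt (1 - k ^ 2 * Real.sin φ ^ 2)) φ :=
  ((continuous_ellipticF_integrand hk).integral_hasStrictDerivAt 0 φ).hasDerivAt

lemma ellipticF_zero : ellipticF 0 k = 0 := intervalIntegral.integral_same

lemma ellipticF_neg (hk : k ∈ Ioo (0 : ℝ) 1) (φ : ℝ) : ellipticF (-φ) k = -ellipticF φ k := by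
  have hd : ∀ u, HasDerivAt (fun u => ellipticF (-u) k + ellipticF u k) 0 u := fun u => by
    have h := (hasDerivAt_ellipticF hk (-u)).comp u (hasDerivAt_neg u)
    rw [Real.sin_neg, neg_sq] at h
    exact (h.add (hasDerivAt_ellipticF hk u)).congr_deriv (by ring)
  have h := is_const_of_deriv_eq_zero (fun u => (hd u).differentiableAt) (fun u => (hd u).deriv) φ 0
  simp only [neg_zero, ellipticF_zero, add_zero] at h
  linarith

lemma ellipticF_add_pi (hk : k ∈ Ioo (0 : ℝ) 1) (φ : ℝ) :
    ellipticF (φ + Real.pi) k = ellipticF φ k + ellipticF Real.pi k := by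
  have hd : ∀ u, HasDerivAt (fun u => ellipticF (u + Real.pi) k - ellipticF u k) 0 u := fun u => by
    have h := (hasDerivAt_ellipticF hk (u + Real.pi)).comp_add_const u Real.pi
    rw [Real.sin_add_pi, neg_sq] at h
    exact (h.sub (hasDerivAt_ellipticF hk u)).congr_deriv (by ring)
  have h := is_const_of_deriv_eq_zero (fun u => (hd u).differentiableAt) (fun u => (hd u).deriv) φ 0
  simp only [zero_add, ellipticF_zero, sub_zero] at h
  linarith

lemma ellipticF_add_int_mul_pi (hk : k ∈ Ioo (0 : ℝ) 1) (φ : ℝ) (n : ℤ) :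
    ellipticF (φ + n * Real.pi) k = ellipticF φ k + n * ellipticF Real.pi k := by
  induction n using Int.induction_on with
  | zero => simp
  | succ n ih =>
    have h := ellipticF_add_pi hk (φ + (n : ℤ) * Real.pi)
    rw [ih] at h
    push_cast at h ⊢
    rw [show φ + (n + 1) * Real.pi = φ + n * Real.pi + Real.pi by ring, h]
    ring
  | pred n ih =>
    have h := ellipticF_add_pi hk (φ + ((-n - 1 : ℤ) : ℝ) * Real.pi)
    rw [show φ + ((-n - 1 : ℤ) : ℝ) * Real.pi + Real.pi = φ + ((-n : ℤ) : ℝ) * Real.pi by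
      push_cast; ring, ih] at h
    push_cast at h ⊢
    linarith

/-- The integral `F(π, k)` is the half-period `2K` of the amplitude. -/
lemma ellipticF_pi_pos (hk : k ∈ Ioo (0 : ℝ) 1) : 0 < ellipticF Real.pi k := by
  simpa [ellipticF_zero] using ellipticF_strictMono hk Real.pi_pos

lemma ellipticF_surjective (hk : k ∈ Ioo (0 : ℝ) 1) :
    Function.Surjective fun φ => ellipticF φ k := by
  have hc : Continuous fun φ => ellipticF φ k :=
    continuous_iff_continuousAt.2 fun φ => (hasDerivAt_ellipticF hk φ).continuousAt
  have hK := ellipticF_pi_pos hk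
  intro u
  obtain ⟨n, hn⟩ := exists_int_lt (u / ellipticF Real.pi k)
  obtain ⟨m, hm⟩ := exists_int_gt (u / ellipticF Real.pi k)
  rw [lt_div_iff₀ hK] at hn
  rw [div_lt_iff₀ hK] at hm
  have en := ellipticF_add_int_mul_pi hk 0 n
  have em := ellipticF_add_int_mul_pi hk 0 m
  rw [ellipticF_zero, zero_add, zero_add] at en em
  exact mem_range_of_exists_le_of_exists_ge hc ⟨_, (en.trans_lt hn).le⟩
    ⟨_, (hm.trans_eq em.symm).le⟩

lemma ellipticF_am (hk : k ∈ Ioo (0 : ℝ) 1) (u : ℝ) : ellipticF (am u k) k = u :=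
  Function.rightInverse_invFun (ellipticF_surjective hk) u

lemma am_eq_iff (hk : k ∈ Ioo (0 : ℝ) 1) {u a : ℝ} : am u k = a ↔ u = ellipticF a k := by
  constructor
  · rintro rfl
    exact (ellipticF_am hk u).symm
  · rintro rfl
    exact am_ellipticF hk a

lemma continuous_am (hk : k ∈ Ioo (0 : ℝ) 1) : Continuous fun u => am u k := by
  have hmono : Monotone fun u => am u k := fun u v huv => by
    rw [← ellipticF_am hk u, ← ellipticF_am hk v] at huv
    exact (ellipticF_strictMono hk).le_iff_le.1 huv
  exact hmono.continuous_of_surjective fun a => ⟨ellipticF a k, am_ellipticF hk a⟩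

lemma hasDerivAt_am (hk : k ∈ Ioo (0 : ℝ) 1) (u : ℝ) :
    HasDerivAt (fun u => am u k) (dn u k) u := by
  have hpos := Real.sqrt_pos.2 (one_sub_pos hk (am u k))
  exact ((hasDerivAt_ellipticF hk (am u k)).of_local_left_inverse (continuous_am hk).continuousAt
    (one_div_pos.2 hpos).ne' (Eventually.of_forall (ellipticF_am hk))).congr_deriv
      (by rw [one_div, inv_inv]; rfl)

lemma dn_pos (hk : k ∈ Ioo (0 : ℝ) 1) (u : ℝ) : 0 < dn u k :=
  Real.sqrt_pos.2 (one_sub_pos hk (am u k))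

lemma dn_sq (hk : k ∈ Ioo (0 : ℝ) 1) (u : ℝ) : dn u k ^ 2 = 1 - k ^ 2 * sn u k ^ 2 :=
  Real.sq_sqrt (one_sub_pos hk (am u k)).le

lemma sn_sq_add_cn_sq (u k : ℝ) : sn u k ^ 2 + cn u k ^ 2 = 1 := Real.sin_sq_add_cos_sq _

lemma hasDerivAt_sn (hk : k ∈ Ioo (0 : ℝ) 1) (u : ℝ) :
    HasDerivAt (fun u => sn u k) (cn u k * dn u k) u := (hasDerivAt_am hk u).sin

lemma hasDerivAt_cn (hk : k ∈ Ioo (0 : ℝ) 1) (u : ℝ) :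
    HasDerivAt (fun u => cn u k) (-sn u k * dn u k) u := (hasDerivAt_am hk u).cos

lemma hasDerivAt_dn (hk : k ∈ Ioo (0 : ℝ) 1) (u : ℝ) :
    HasDerivAt (fun u => dn u k) (-(k ^ 2 * sn u k * cn u k)) u := by
  have hpos := dn_pos hk u
  refine (((((hasDerivAt_sn hk u).pow 2).const_mul (k ^ 2)).const_sub 1).sqrt
    (one_sub_pos hk (am u k)).ne').congr_deriv ?_
  change -(k ^ 2 * _) / (2 * dn u k) = _
  field_simp
  simp
  ring

/-- The symmetries `a ↦ nπ - a` of the amplitude correspond to `u ↦ 2nK - u`, and the fixed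
point of the former to the fixed point of the latter. -/
lemma am_add_am_eq_iff (hk : k ∈ Ioo (0 : ℝ) 1) (u v : ℝ) (n : ℤ) :
    am u k + am v k = n * Real.pi ↔ am ((u + v) / 2) k = n * Real.pi / 2 := by
  have key : ∀ a, ellipticF (n * Real.pi - a) k = n * ellipticF Real.pi k - ellipticF a k :=
    fun a => by
      rw [sub_eq_neg_add, ellipticF_add_int_mul_pi hk, ellipticF_neg hk]
      ring
  have hhalf := key (n * Real.pi / 2)
  rw [show n * Real.pi - n * Real.pi / 2 = n * Real.pi / 2 by ring] at hhalf
  rw [← eq_sub_iff_add_eq, am_eq_iff hk, am_eq_iff hk, key, ellipticF_am hk]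
  constructor <;> intro h <;> linarith

lemma cn_half_add_eq_zero_iff (hk : k ∈ Ioo (0 : ℝ) 1) (u v : ℝ) :
    cn ((u + v) / 2) k = 0 ↔ cn v k = -cn u k ∧ sn v k = sn u k := by
  have h1 : cn ((u + v) / 2) k = 0 ↔ ∃ n : ℤ, am u k + am v k = (2 * n + 1) * Real.pi := by
    rw [cn, Real.cos_eq_zero_iff]
    refine exists_congr fun n => ?_
    have h := am_add_am_eq_iff hk u v (2 * n + 1)
    push_cast at h
    exact h.symm
  have h2 : (cn v k = -cn u k ∧ sn v k = sn u k) ↔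
      ((am v k : ℝ) : Real.Angle) = ((Real.pi - am u k : ℝ) : Real.Angle) := by
    constructor
    · rintro ⟨hc, hs⟩
      exact Real.Angle.cos_sin_inj (by rw [Real.cos_pi_sub]; exact hc)
        (by rw [Real.sin_pi_sub]; exact hs)
    · intro h
      have hc := congrArg Real.Angle.cos h
      have hs := congrArg Real.Angle.sin h
      rw [Real.Angle.cos_coe, Real.Angle.cos_coe, Real.cos_pi_sub] at hc
      rw [Real.Angle.sin_coe, Real.Angle.sin_coe, Real.sin_pi_sub] at hs
      exact ⟨hc, hs⟩
  rw [h1, h2, Real.Angle.angle_eq_iff_two_pi_dvd_sub]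
  refine exists_congr fun n => ?_
  constructor <;> intro h <;> linarith

lemma sn_half_add_eq_zero_iff (hk : k ∈ Ioo (0 : ℝ) 1) (u v : ℝ) :
    sn ((u + v) / 2) k = 0 ↔ cn v k = cn u k ∧ sn v k = -sn u k := by
  have h1 : sn ((u + v) / 2) k = 0 ↔ ∃ n : ℤ, am u k + am v k = 2 * n * Real.pi := by
    rw [sn, Real.sin_eq_zero_iff]
    refine exists_congr fun n => ?_
    have h := am_add_am_eq_iff hk u v (2 * n)
    push_cast at h
    rw [h, eq_comm, mul_assoc, mul_div_cancel_left₀ _ two_ne_zero]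
  have h2 : (cn v k = cn u k ∧ sn v k = -sn u k) ↔
      ((am v k : ℝ) : Real.Angle) = ((-am u k : ℝ) : Real.Angle) := by
    constructor
    · rintro ⟨hc, hs⟩
      exact Real.Angle.cos_sin_inj (by rw [Real.cos_neg]; exact hc)
        (by rw [Real.sin_neg]; exact hs)
    · intro h
      have hc := congrArg Real.Angle.cos h
      have hs := congrArg Real.Angle.sin h
      rw [Real.Angle.cos_coe, Real.Angle.cos_coe, Real.cos_neg] at hc
      rw [Real.Angle.sin_coe, Real.Angle.sin_coe, Real.sin_neg] at hs
      exact ⟨hc, hs⟩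
  rw [h1, h2, Real.Angle.angle_eq_iff_two_pi_dvd_sub]
  refine exists_congr fun n => ?_
  constructor <;> intro h <;> linarith

lemma sn_mul_cn_half_add_eq_zero_iff (hk : k ∈ Ioo (0 : ℝ) 1) (u v : ℝ) :
    sn ((u + v) / 2) k * cn ((u + v) / 2) k = 0 ↔
      sn v k ^ 2 = sn u k ^ 2 ∧ sn v k * cn v k = -(sn u k * cn u k) := by
  rw [mul_eq_zero, sn_half_add_eq_zero_iff hk, cn_half_add_eq_zero_iff hk]
  have hu := sn_sq_add_cn_sq u k
  have hv := sn_sq_add_cn_sq v k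
  constructor
  · rintro (⟨hc, hs⟩ | ⟨hc, hs⟩) <;> rw [hc, hs] <;> constructor <;> ring
  · rintro ⟨hs, hsc⟩
    have hc : cn v k ^ 2 = cn u k ^ 2 := by linarith
    rcases sq_eq_sq_iff_eq_or_eq_neg.1 hs with h | h <;>
      rcases sq_eq_sq_iff_eq_or_eq_neg.1 hc with h' | h' <;> rw [h, h'] at hsc ⊢
    · have h0 : sn u k * cn u k = 0 := by linarith
      rcases mul_eq_zero.1 h0 with h0 | h0 <;> simp [h0]
    · simp
    · simp
    · have h0 : sn u k * cn u k = 0 := by linarith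
      rcases mul_eq_zero.1 h0 with h0 | h0 <;> simp [h0]

end Jacobi

/-! ### Vertical part of an extremal -/

/-- A curve that solves the vertical subsystem and starts at `ν` is the vertical part of the
extremal of `ν`. -/
lemma extremal_vertical_eq {ν : Covector} {a b c : ℝ → ℝ}
    (ha : ∀ s, HasDerivAt a (-(b s * c s)) s) (hb : ∀ s, HasDerivAt b (c s) s)
    (hc : ∀ s, HasDerivAt c (a s * b s) s) (h0 : (⟨a 0, b 0, c 0⟩ : Covector) = ν) (s : ℝ) :
    ν.extremal.vertical s = ⟨a s, b s, c s⟩ := by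
  let v : ℝ × ℝ × ℝ → ℝ × ℝ × ℝ := fun p => (-(p.2.1 * p.2.2), p.2.2, p.1 * p.2.1)
  have hv : ContDiff ℝ 1 v := by fun_prop
  have hf : ∀ t, HasDerivAt (fun s => (ν.extremal.h₁ s, ν.extremal.h₂ s, ν.extremal.h₃ s))
      (v (ν.extremal.h₁ t, ν.extremal.h₂ t, ν.extremal.h₃ t)) t := fun t =>
    (ν.extremal.deriv_h₁ t).prodMk ((ν.extremal.deriv_h₂ t).prodMk (ν.extremal.deriv_h₃ t))
  have hg : ∀ t, HasDerivAt (fun s => (a s, b s, c s)) (v (a t, b t, c t)) t := fun t =>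
    (ha t).prodMk ((hb t).prodMk (hc t))
  have key := congrFun (ode_global_unique hv hf hg (by
    simp only [extremal_h₁_zero, extremal_h₂_zero, extremal_h₃_zero, ← h0])) s
  simp only [Prod.mk.injEq] at key
  exact Covector.ext key.1 key.2.1 key.2.2

lemma reflect₁_eq_self_iff (t : ℝ) (ν : Covector) : reflect t .ε₁ ν = ν ↔
    (ν.extremal.vertical t).h₁ = (ν.extremal.vertical 0).h₁ ∧
    (ν.extremal.vertical t).h₂ = -(ν.extremal.vertical 0).h₂ ∧
    (ν.extremal.vertical t).h₃ = (ν.extremal.vertical 0).h₃ := by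
  rw [ν.extremal_vertical_zero, Covector.ext_iff]
  exact and_congr_right' (and_congr_left' neg_eq_iff_eq_neg)

lemma reflect₂_eq_self_iff (t : ℝ) (ν : Covector) : reflect t .ε₂ ν = ν ↔
    (ν.extremal.vertical t).h₁ = (ν.extremal.vertical 0).h₁ ∧
    (ν.extremal.vertical t).h₂ = (ν.extremal.vertical 0).h₂ ∧
    (ν.extremal.vertical t).h₃ = -(ν.extremal.vertical 0).h₃ := by
  rw [ν.extremal_vertical_zero, Covector.ext_iff]
  exact and_congr_right' (and_congr_right' neg_eq_iff_eq_neg)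

namespace Covector

lemma r_sq (ν : Covector) : ν.r ^ 2 = ν.h₁ ^ 2 + ν.h₃ ^ 2 := Real.sq_sqrt (by positivity)

lemma abs_h₁_le (ν : Covector) : |ν.h₁| ≤ ν.r :=
  Real.abs_le_sqrt (by nlinarith [sq_nonneg ν.h₃])

/-- The force in terms of the half angle. -/
lemma IsAngle.h₁_h₃ {ν : Covector} {β : ℝ} (h : ν.IsAngle β) :
    ν.h₁ = -ν.r * (1 - 2 * Real.sin (β / 2) ^ 2) ∧
      ν.h₃ = -2 * ν.r * Real.sin (β / 2) * Real.cos (β / 2) := by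
  have hc : Real.cos β = 1 - 2 * Real.sin (β / 2) ^ 2 := by
    have h2 := Real.cos_two_mul (β / 2)
    rw [mul_div_cancel₀ β two_ne_zero] at h2
    linarith [Real.sin_sq_add_cos_sq (β / 2)]
  have hs : Real.sin β = 2 * Real.sin (β / 2) * Real.cos (β / 2) := by
    rw [← Real.sin_two_mul, mul_div_cancel₀ β two_ne_zero]
  constructor
  · rw [h.1, Real.cos_sub_pi, hc]
    ring
  · rw [h.2, Real.sin_sub_pi, hs]
    ring

lemma r_pos {ν : Covector} (h : ν.r ≠ 0) : 0 < ν.r := lt_of_le_of_ne ν.r_nonneg (Ne.symm h)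

/-- If the control and its derivative vanish initially, then the energy is `h₁ = ± r`. -/
lemma energy_sq_of_h₂_h₃ {ν : Covector} (h₂ : ν.h₂ = 0) (h₃ : ν.h₃ = 0) :
    ν.energy ^ 2 = ν.r ^ 2 := by
  rw [r_sq, energy, c, h₂, h₃]
  ring

end Covector

lemma sign_sq {c : ℝ} (h : c ≠ 0) : Real.sign c ^ 2 = 1 := by
  rcases lt_or_gt_of_ne h with h | h
  · rw [Real.sign_of_neg h, neg_one_sq]
  · rw [Real.sign_of_pos h, one_pow]

/-! ### Oscillating pendulum -/

section N₁

variable {ν : Covector} {k φ : ℝ}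

lemma IsEllipticCoord₁.modulus_mem (hν : ν ∈ N₁) (h : IsEllipticCoord₁ ν k φ) :
    k ∈ Ioo (0 : ℝ) 1 := by
  have hr := Covector.r_pos hν.1
  have hE := hν.2
  rw [h.1]
  refine ⟨Real.sqrt_pos.2 (div_pos (by linarith [hE.1]) (by linarith)), ?_⟩
  rw [Real.sqrt_lt' one_pos, one_pow, div_lt_one (by linarith)]
  linarith [hE.2]

lemma IsEllipticCoord₁.vertical_eq (hν : ν ∈ N₁) (h : IsEllipticCoord₁ ν k φ) (s : ℝ) :
    ν.extremal.vertical s =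
      ⟨-ν.r * (1 - 2 * (k * sn (Real.sqrt ν.r * (φ + s)) k) ^ 2),
        2 * k * Real.sqrt ν.r * cn (Real.sqrt ν.r * (φ + s)) k,
        -2 * ν.r * (k * sn (Real.sqrt ν.r * (φ + s)) k) * dn (Real.sqrt ν.r * (φ + s)) k⟩ := by
  have hk := h.modulus_mem hν
  obtain ⟨-, β, hβ, hs, hc, hd⟩ := h
  have hr2 : Real.sqrt ν.r ^ 2 = ν.r := Real.sq_sqrt ν.r_nonneg
  set ρ := Real.sqrt ν.r
  have hu : ∀ s, HasDerivAt (fun s => ρ * (φ + s)) ρ s := fun s =>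
    (((hasDerivAt_id s).const_add φ).const_mul ρ).congr_deriv (mul_one ρ)
  have dsn : ∀ s, HasDerivAt (fun s => sn (ρ * (φ + s)) k) _ s := fun s =>
    HasDerivAt.comp (h₂ := fun u => sn u k) s (hasDerivAt_sn hk (ρ * (φ + s))) (hu s)
  have dcn : ∀ s, HasDerivAt (fun s => cn (ρ * (φ + s)) k) _ s := fun s =>
    HasDerivAt.comp (h₂ := fun u => cn u k) s (hasDerivAt_cn hk (ρ * (φ + s))) (hu s)
  have ddn : ∀ s, HasDerivAt (fun s => dn (ρ * (φ + s)) k) _ s := fun s =>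
    HasDerivAt.comp (h₂ := fun u => dn u k) s (hasDerivAt_dn hk (ρ * (φ + s))) (hu s)
  apply extremal_vertical_eq
    (a := fun s => -ν.r * (1 - 2 * (k * sn (ρ * (φ + s)) k) ^ 2))
    (b := fun s => 2 * k * ρ * cn (ρ * (φ + s)) k)
    (c := fun s => -2 * ν.r * (k * sn (ρ * (φ + s)) k) * dn (ρ * (φ + s)) k)
  · intro s
    refine ((((((dsn s).const_mul k).pow 2).const_mul 2).const_sub 1).const_mul
      (-ν.r)).congr_deriv ?_
    simp only [Nat.cast_ofNat, Nat.add_one_sub_one, pow_one]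
    ring
  · intro s
    refine ((dcn s).const_mul (2 * k * ρ)).congr_deriv ?_
    linear_combination (-2 * k * sn (ρ * (φ + s)) k * dn (ρ * (φ + s)) k) * hr2
  · intro s
    refine ((((dsn s).const_mul k).const_mul (-2 * ν.r)).mul (ddn s)).congr_deriv ?_
    linear_combination (-2 * ν.r * k * cn (ρ * (φ + s)) k * ρ) * dn_sq hk (ρ * (φ + s))
  · have e := hβ.h₁_h₃
    rw [hs, hd] at e
    simp only [Covector.ext_iff, add_zero]
    refine ⟨e.1.symm, ?_, e.2.symm⟩
    rw [Covector.c] at hc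
    linarith

lemma tau_eq (ν : Covector) (φ t : ℝ) :
    tau ν φ t = (Real.sqrt ν.r * (φ + 0) + Real.sqrt ν.r * (φ + t)) / 2 := by
  rw [tau]
  ring

lemma dn_eq_of_sn_sq_eq {u v : ℝ} (h : sn v k ^ 2 = sn u k ^ 2) : dn v k = dn u k := by
  rw [dn, dn, h]

lemma IsEllipticCoord₁.reflect₁_eq_self_iff (hν : ν ∈ N₁) (h : IsEllipticCoord₁ ν k φ) (t : ℝ) :
    reflect t .ε₁ ν = ν ↔ cn (tau ν φ t) k = 0 := by
  have hk := h.modulus_mem hν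
  have hr := Covector.r_pos hν.1
  have hρ := Real.sqrt_pos.2 hr
  rw [Elastica.reflect₁_eq_self_iff, tau_eq, cn_half_add_eq_zero_iff hk, h.vertical_eq hν,
    h.vertical_eq hν]
  have hk0 := hk.1
  generalize Real.sqrt ν.r * (φ + t) = v
  generalize Real.sqrt ν.r * (φ + 0) = u
  dsimp only
  constructor
  · rintro ⟨-, h₂, h₃⟩
    have hc : cn v k = -cn u k := by
      apply mul_left_cancel₀ (by positivity : 2 * k * Real.sqrt ν.r ≠ 0)
      linarith
    have hs : sn v k ^ 2 = sn u k ^ 2 := by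
      have hu := sn_sq_add_cn_sq u k
      have hv := sn_sq_add_cn_sq v k
      rw [hc] at hv
      linarith
    have hd := dn_pos hk u
    rw [dn_eq_of_sn_sq_eq hs] at h₃
    refine ⟨hc, ?_⟩
    apply mul_left_cancel₀ (by positivity : 2 * ν.r * k * dn u k ≠ 0)
    linarith
  · rintro ⟨hc, hs⟩
    rw [dn_eq_of_sn_sq_eq (by rw [hs] : sn v k ^ 2 = sn u k ^ 2), hs, hc]
    exact ⟨rfl, by ring, rfl⟩

lemma IsEllipticCoord₁.reflect₂_eq_self_iff (hν : ν ∈ N₁) (h : IsEllipticCoord₁ ν k φ) (t : ℝ) :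
    reflect t .ε₂ ν = ν ↔ sn (tau ν φ t) k = 0 := by
  have hk := h.modulus_mem hν
  have hr := Covector.r_pos hν.1
  have hρ := Real.sqrt_pos.2 hr
  rw [Elastica.reflect₂_eq_self_iff, tau_eq, sn_half_add_eq_zero_iff hk, h.vertical_eq hν,
    h.vertical_eq hν]
  have hk0 := hk.1
  generalize Real.sqrt ν.r * (φ + t) = v
  generalize Real.sqrt ν.r * (φ + 0) = u
  dsimp only
  constructor
  · rintro ⟨-, h₂, h₃⟩
    have hc : cn v k = cn u k := by
      apply mul_left_cancel₀ (by positivity : 2 * k * Real.sqrt ν.r ≠ 0)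
      linarith
    have hs : sn v k ^ 2 = sn u k ^ 2 := by
      have hu := sn_sq_add_cn_sq u k
      have hv := sn_sq_add_cn_sq v k
      rw [hc] at hv
      linarith
    have hd := dn_pos hk u
    rw [dn_eq_of_sn_sq_eq hs] at h₃
    refine ⟨hc, ?_⟩
    apply mul_left_cancel₀ (by positivity : 2 * ν.r * k * dn u k ≠ 0)
    linarith
  · rintro ⟨hc, hs⟩
    rw [dn_eq_of_sn_sq_eq (by rw [hs, neg_sq] : sn v k ^ 2 = sn u k ^ 2), hs, hc]
    exact ⟨by ring, rfl, by ring⟩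

lemma reflect₃_ne_self_of_mem_N₁ (hν : ν ∈ N₁) (t : ℝ) : reflect t .ε₃ ν ≠ ν := by
  intro h
  rw [reflect₃_eq_self_iff] at h
  obtain ⟨hE₁, hE₂⟩ := hν.2
  nlinarith [Covector.energy_sq_of_h₂_h₃ h.1 h.2]

end N₁

/-! ### Rotating pendulum -/

section N₂

variable {ν : Covector} {k ψ : ℝ}

lemma IsEllipticCoord₂.modulus_mem (hν : ν ∈ N₂) (h : IsEllipticCoord₂ ν k ψ) :
    k ∈ Ioo (0 : ℝ) 1 := by
  have hr := Covector.r_pos hν.1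
  have hE : ν.r < ν.energy := hν.2
  rw [h.1]
  refine ⟨Real.sqrt_pos.2 (div_pos (by linarith) (by linarith)), ?_⟩
  rw [Real.sqrt_lt' one_pos, one_pow, div_lt_one (by linarith)]
  linarith

lemma c_ne_zero_of_mem_N₂ (hν : ν ∈ N₂) : ν.c ≠ 0 := by
  intro h
  have hE : ν.r < ν.energy := hν.2
  rw [Covector.energy, h] at hE
  linarith [le_abs_self ν.h₁, ν.abs_h₁_le]

lemma IsEllipticCoord₂.vertical_eq (hν : ν ∈ N₂) (h : IsEllipticCoord₂ ν k ψ) (s : ℝ) :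
    ν.extremal.vertical s =
      ⟨-ν.r * (1 - 2 * sn (Real.sqrt ν.r * (ψ + s / k)) k ^ 2),
        2 * Real.sign ν.c * (Real.sqrt ν.r / k) * dn (Real.sqrt ν.r * (ψ + s / k)) k,
        -2 * ν.r * Real.sign ν.c * (sn (Real.sqrt ν.r * (ψ + s / k)) k *
          cn (Real.sqrt ν.r * (ψ + s / k)) k)⟩ := by
  have hk := h.modulus_mem hν
  have hσ := sign_sq (c_ne_zero_of_mem_N₂ hν)
  have hk0 := hk.1.ne'
  obtain ⟨-, β, hβ, hs, hc, hd⟩ := h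
  have hr2 : Real.sqrt ν.r ^ 2 = ν.r := Real.sq_sqrt ν.r_nonneg
  set ρ := Real.sqrt ν.r
  set σ := Real.sign ν.c
  have hu : ∀ s, HasDerivAt (fun s => ρ * (ψ + s / k)) (ρ / k) s := fun s =>
    ((((hasDerivAt_id s).div_const k).const_add ψ).const_mul ρ).congr_deriv (by ring)
  have dsn : ∀ s, HasDerivAt (fun s => sn (ρ * (ψ + s / k)) k) _ s := fun s =>
    HasDerivAt.comp (h₂ := fun u => sn u k) s (hasDerivAt_sn hk (ρ * (ψ + s / k))) (hu s)
  have dcn : ∀ s, HasDerivAt (fun s => cn (ρ * (ψ + s / k)) k) _ s := fun s =>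
    HasDerivAt.comp (h₂ := fun u => cn u k) s (hasDerivAt_cn hk (ρ * (ψ + s / k))) (hu s)
  have ddn : ∀ s, HasDerivAt (fun s => dn (ρ * (ψ + s / k)) k) _ s := fun s =>
    HasDerivAt.comp (h₂ := fun u => dn u k) s (hasDerivAt_dn hk (ρ * (ψ + s / k))) (hu s)
  apply extremal_vertical_eq
    (a := fun s => -ν.r * (1 - 2 * sn (ρ * (ψ + s / k)) k ^ 2))
    (b := fun s => 2 * σ * (ρ / k) * dn (ρ * (ψ + s / k)) k)
    (c := fun s => -2 * ν.r * σ * (sn (ρ * (ψ + s / k)) k * cn (ρ * (ψ + s / k)) k))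
  · intro s
    refine (((((dsn s).pow 2).const_mul 2).const_sub 1).const_mul (-ν.r)).congr_deriv ?_
    simp only [Nat.cast_ofNat, Nat.add_one_sub_one, pow_one]
    linear_combination (-4 * ν.r * (ρ / k) * sn (ρ * (ψ + s / k)) k * cn (ρ * (ψ + s / k)) k *
      dn (ρ * (ψ + s / k)) k) * hσ
  · intro s
    refine ((ddn s).const_mul (2 * σ * (ρ / k))).congr_deriv ?_
    rw [← hr2]
    field_simp
  · intro s
    refine (((dsn s).mul (dcn s)).const_mul (-2 * ν.r * σ)).congr_deriv ?_
    linear_combination (-2 * ν.r * σ * (ρ / k) * dn (ρ * (ψ + s / k)) k) *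
      sn_sq_add_cn_sq (ρ * (ψ + s / k)) k
  · have e := hβ.h₁_h₃
    rw [hs, hd] at e
    simp only [Covector.ext_iff, zero_div, add_zero]
    refine ⟨?_, ?_, ?_⟩
    · rw [e.1, mul_pow, hσ, one_mul]
    · rw [Covector.c] at hc
      linarith
    · rw [e.2]
      ring

lemma tau₂_eq (ν : Covector) (k ψ t : ℝ) :
    tau₂ ν k ψ t = (Real.sqrt ν.r * (ψ + 0 / k) + Real.sqrt ν.r * (ψ + t / k)) / 2 := by
  rw [tau₂]
  ring

/-- The rotating pendulum never changes its direction of rotation. -/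
lemma IsEllipticCoord₂.reflect₁_ne_self (hν : ν ∈ N₂) (h : IsEllipticCoord₂ ν k ψ) (t : ℝ) :
    reflect t .ε₁ ν ≠ ν := by
  have hk := h.modulus_mem hν
  have hρ := Real.sqrt_pos.2 (Covector.r_pos hν.1)
  have hσ : Real.sign ν.c ≠ 0 := by simpa [Real.sign_eq_zero_iff] using c_ne_zero_of_mem_N₂ hν
  rw [Ne, Elastica.reflect₁_eq_self_iff, h.vertical_eq hν, h.vertical_eq hν]
  have hk0 := hk.1
  rintro ⟨-, h₂, -⟩
  have hd := dn_pos hk (Real.sqrt ν.r * (ψ + t / k))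
  have hd' := dn_pos hk (Real.sqrt ν.r * (ψ + 0 / k))
  dsimp only at h₂
  rw [← mul_neg] at h₂
  have := mul_left_cancel₀ (by positivity) h₂
  linarith

lemma IsEllipticCoord₂.reflect₂_eq_self_iff (hν : ν ∈ N₂) (h : IsEllipticCoord₂ ν k ψ) (t : ℝ) :
    reflect t .ε₂ ν = ν ↔ sn (tau₂ ν k ψ t) k * cn (tau₂ ν k ψ t) k = 0 := by
  have hk := h.modulus_mem hν
  have hr := Covector.r_pos hν.1
  have hσ : Real.sign ν.c ≠ 0 := by simpa [Real.sign_eq_zero_iff] using c_ne_zero_of_mem_N₂ hν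
  rw [Elastica.reflect₂_eq_self_iff, tau₂_eq, sn_mul_cn_half_add_eq_zero_iff hk,
    h.vertical_eq hν, h.vertical_eq hν]
  generalize Real.sqrt ν.r * (ψ + t / k) = v
  generalize Real.sqrt ν.r * (ψ + 0 / k) = u
  dsimp only
  rw [← mul_neg]
  constructor
  · rintro ⟨h₁, -, h₃⟩
    have h₁' := mul_left_cancel₀ (neg_ne_zero.2 hr.ne') h₁
    exact ⟨by linarith, mul_left_cancel₀ (by simp [hr.ne', hσ]) h₃⟩
  · rintro ⟨hs, hsc⟩
    rw [hs, hsc, dn_eq_of_sn_sq_eq hs]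
    exact ⟨rfl, rfl, rfl⟩

lemma reflect₃_ne_self_of_mem_N₂ (hν : ν ∈ N₂) (t : ℝ) : reflect t .ε₃ ν ≠ ν :=
  fun h => c_ne_zero_of_mem_N₂ hν ((reflect₃_eq_self_iff t ν).1 h).1

end N₂

/-! ### Separatrix motion of the pendulum -/

section N₃

variable {ν : Covector} {φ : ℝ}

lemma c_ne_zero_of_mem_N₃ (hν : ν ∈ N₃) : ν.c ≠ 0 := by
  obtain ⟨hr, hE, hπ⟩ := hν
  intro h
  rw [Covector.energy, h] at hE
  have h₁ : ν.h₁ = ν.r := by linarith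
  have h₃ : ν.h₃ = 0 := by
    have hsq := ν.r_sq
    rw [h₁] at hsq
    exact pow_eq_zero_iff two_ne_zero |>.1 (by linarith)
  exact hπ ⟨by simp [h₁], by simp [h₃]⟩

lemma IsEllipticCoord₃.vertical_eq (hν : ν ∈ N₃) (h : IsEllipticCoord₃ ν φ) (s : ℝ) :
    ν.extremal.vertical s =
      ⟨ν.r * (1 - 2 / Real.cosh (Real.sqrt ν.r * (φ + s)) ^ 2),
        2 * Real.sign ν.c * Real.sqrt ν.r / Real.cosh (Real.sqrt ν.r * (φ + s)),
        -2 * ν.r * Real.sign ν.c * Real.sinh (Real.sqrt ν.r * (φ + s)) /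
          Real.cosh (Real.sqrt ν.r * (φ + s)) ^ 2⟩ := by
  have hσ := sign_sq (c_ne_zero_of_mem_N₃ hν)
  obtain ⟨β, hβ, hs, hc, hd⟩ := h
  have hr2 : Real.sqrt ν.r ^ 2 = ν.r := Real.sq_sqrt ν.r_nonneg
  set ρ := Real.sqrt ν.r
  set σ := Real.sign ν.c
  have hu : ∀ s, HasDerivAt (fun s => ρ * (φ + s)) ρ s := fun s =>
    (((hasDerivAt_id s).const_add φ).const_mul ρ).congr_deriv (mul_one ρ)
  have dS : ∀ s, HasDerivAt (fun s => Real.sinh (ρ * (φ + s))) _ s := fun s => (hu s).sinh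
  have dC : ∀ s, HasDerivAt (fun s => Real.cosh (ρ * (φ + s))) _ s := fun s => (hu s).cosh
  have hC0 : ∀ s, Real.cosh (ρ * (φ + s)) ≠ 0 := fun s => (Real.cosh_pos _).ne'
  apply extremal_vertical_eq
    (a := fun s => ν.r * (1 - 2 / Real.cosh (ρ * (φ + s)) ^ 2))
    (b := fun s => 2 * σ * ρ / Real.cosh (ρ * (φ + s)))
    (c := fun s => -2 * ν.r * σ * Real.sinh (ρ * (φ + s)) / Real.cosh (ρ * (φ + s)) ^ 2)
  · intro s
    refine ((((hasDerivAt_const s (2 : ℝ)).div ((dC s).pow 2)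
      (pow_ne_zero 2 (hC0 s))).const_sub 1).const_mul ν.r).congr_deriv ?_
    have h0 := hC0 s
    simp only [Nat.cast_ofNat, Nat.add_one_sub_one, pow_one, Pi.pow_apply]
    field_simp
    rw [hσ]
    ring
  · intro s
    refine ((hasDerivAt_const s (2 * σ * ρ)).div (dC s) (hC0 s)).congr_deriv ?_
    rw [← hr2]
    ring
  · intro s
    refine (((dS s).const_mul (-2 * ν.r * σ)).div ((dC s).pow 2)
      (pow_ne_zero 2 (hC0 s))).congr_deriv ?_
    have h0 := hC0 s
    have hCS := Real.cosh_sq (ρ * (φ + s))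
    simp only [Nat.cast_ofNat, Nat.add_one_sub_one, pow_one, Pi.pow_apply]
    field_simp
    rw [show Real.sinh (ρ * (φ + s)) ^ 2 = Real.cosh (ρ * (φ + s)) ^ 2 - 1 by linarith]
    ring
  · have e := hβ.h₁_h₃
    rw [hs, hd] at e
    have h0 := (Real.cosh_pos (ρ * φ)).ne'
    have hCS := Real.cosh_sq (ρ * φ)
    rw [Real.tanh_eq_sinh_div_cosh] at e
    simp only [Covector.ext_iff, add_zero]
    refine ⟨?_, ?_, ?_⟩
    · rw [e.1, mul_pow, hσ, div_pow,
        show Real.sinh (ρ * φ) ^ 2 = Real.cosh (ρ * φ) ^ 2 - 1 by linarith]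
      field_simp
      ring
    · rw [Covector.c] at hc
      rw [show ν.h₂ = 2 * (ν.h₂ / 2) by ring, hc]
      ring
    · rw [e.2]
      field_simp

/-- On the separatrix the pendulum never changes its direction of rotation. -/
lemma IsEllipticCoord₃.reflect₁_ne_self (hν : ν ∈ N₃) (h : IsEllipticCoord₃ ν φ) (t : ℝ) :
    reflect t .ε₁ ν ≠ ν := by
  have hρ := Real.sqrt_pos.2 (Covector.r_pos hν.1)
  have hσ : Real.sign ν.c ≠ 0 := by simpa [Real.sign_eq_zero_iff] using c_ne_zero_of_mem_N₃ hν
  rw [Ne, Elastica.reflect₁_eq_self_iff, h.vertical_eq hν, h.vertical_eq hν]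
  rintro ⟨-, h₂, -⟩
  have hC := Real.cosh_pos (Real.sqrt ν.r * (φ + t))
  have hC' := Real.cosh_pos (Real.sqrt ν.r * (φ + 0))
  dsimp only at h₂
  rw [div_eq_mul_inv, div_eq_mul_inv, ← mul_neg] at h₂
  have := mul_left_cancel₀ (by positivity) h₂
  linarith [inv_pos.2 hC, inv_pos.2 hC']

lemma IsEllipticCoord₃.reflect₂_eq_self_iff (hν : ν ∈ N₃) (h : IsEllipticCoord₃ ν φ) (t : ℝ) :
    reflect t .ε₂ ν = ν ↔ tau ν φ t = 0 := by
  have hr := Covector.r_pos hν.1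
  have hρ := Real.sqrt_pos.2 hr
  have hσ : Real.sign ν.c ≠ 0 := by simpa [Real.sign_eq_zero_iff] using c_ne_zero_of_mem_N₃ hν
  rw [Elastica.reflect₂_eq_self_iff, tau_eq, h.vertical_eq hν, h.vertical_eq hν]
  generalize Real.sqrt ν.r * (φ + t) = v
  generalize Real.sqrt ν.r * (φ + 0) = u
  dsimp only
  constructor
  · rintro ⟨-, h₂, h₃⟩
    have hC : Real.cosh v = Real.cosh u := by
      rw [div_eq_mul_inv, div_eq_mul_inv] at h₂
      exact inv_injective (mul_left_cancel₀ (by positivity) h₂)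
    have hC0 := Real.cosh_pos u
    rw [hC, ← neg_div, div_left_inj' (by positivity), ← mul_neg] at h₃
    have hS := mul_left_cancel₀ (by simp [hr.ne', hσ]) h₃
    rw [← Real.sinh_neg] at hS
    rw [Real.sinh_injective hS]
    ring
  · intro huv
    rw [show v = -u by linarith, Real.cosh_neg, Real.sinh_neg]
    exact ⟨rfl, rfl, by ring⟩

lemma reflect₃_ne_self_of_mem_N₃ (hν : ν ∈ N₃) (t : ℝ) : reflect t .ε₃ ν ≠ ν :=
  fun h => c_ne_zero_of_mem_N₃ hν ((reflect₃_eq_self_iff t ν).1 h).1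

/-- On the separatrix no elastica returns to its starting point with the opposite direction.
If it did, the curvature `h₂` and hence `h₁` would have the same value at both ends, while the
half turn changes the sign of `h₁`; so `h₁` vanishes at both ends. By Rolle's theorem, applied to
the coordinate along the constant vector `h₁ X₁ + h₃ X₃`, it vanishes in between as well; but on
the whole time axis it vanishes at two times at most. -/
lemma IsEllipticCoord₃.Exp_ne (hν : ν ∈ N₃) (h : IsEllipticCoord₃ ν φ) {t : ℝ} (ht : 0 < t) :
    Exp t ν ≠ ⟨0, 0, (Real.pi : Real.Angle)⟩ := by
  intro hq
  have hr := Covector.r_pos hν.1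
  have hρ := Real.sqrt_pos.2 hr
  have hx : ν.extremal.x t = 0 := congrArg Config.x hq
  have hy : ν.extremal.y t = 0 := congrArg Config.y hq
  have hθ : (ν.extremal.θ t : Real.Angle) = (Real.pi : Real.Angle) := congrArg Config.θ hq
  have hcos : Real.cos (ν.extremal.θ t) = -1 := by simpa using congrArg Real.Angle.cos hθ
  have hsin : Real.sin (ν.extremal.θ t) = 0 := by simpa using congrArg Real.Angle.sin hθ
  have hrot : ∀ s, ν.extremal.h₁ s =
        ν.h₁ * Real.cos (ν.extremal.θ s) - ν.h₃ * Real.sin (ν.extremal.θ s) ∧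
      ν.extremal.h₃ s =
        ν.h₁ * Real.sin (ν.extremal.θ s) + ν.h₃ * Real.cos (ν.extremal.θ s) := fun s => by
    obtain ⟨f₁, f₃⟩ := extremal_force ν s
    have hsc := Real.sin_sq_add_cos_sq (ν.extremal.θ s)
    rw [← f₁, ← neg_eq_iff_eq_neg.2 f₃]
    constructor
    · linear_combination (-ν.extremal.h₁ s) * hsc
    · linear_combination (-ν.extremal.h₃ s) * hsc
  have hd₁ : ∀ s, HasDerivAt (fun s => ν.h₁ * ν.extremal.x s - ν.h₃ * ν.extremal.y s)
      (ν.extremal.h₁ s) s := fun s =>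
    (((ν.extremal.deriv_x s).const_mul ν.h₁).sub
      ((ν.extremal.deriv_y s).const_mul ν.h₃)).congr_deriv (hrot s).1.symm
  have hd₂ : ∀ s, HasDerivAt
      (fun s => ν.extremal.h₂ s - (ν.h₁ * ν.extremal.y s + ν.h₃ * ν.extremal.x s)) 0 s := fun s =>
    ((ν.extremal.deriv_h₂ s).sub (((ν.extremal.deriv_y s).const_mul ν.h₁).add
      ((ν.extremal.deriv_x s).const_mul ν.h₃))).congr_deriv (by rw [(hrot s).2]; ring)
  have h₂ : ν.extremal.h₂ t = ν.extremal.h₂ 0 := by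
    have := is_const_of_deriv_eq_zero (fun s => (hd₂ s).differentiableAt)
      (fun s => (hd₂ s).deriv) t 0
    simpa [hx, hy, ν.extremal.x_zero, ν.extremal.y_zero] using this
  have h₁t : ν.extremal.h₁ t = ν.extremal.h₁ 0 := by
    have e₁ := extremal_energy ν t
    have e₂ := extremal_energy ν 0
    rw [h₂] at e₁
    linarith
  have hneg : ν.extremal.h₁ t = -ν.extremal.h₁ 0 := by
    rw [(hrot t).1, hcos, hsin, extremal_h₁_zero]
    ring
  obtain ⟨s, hs, hs0⟩ := exists_hasDerivAt_eq_zero ht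
    (fun s _ => (hd₁ s).continuousAt.continuousWithinAt)
    (by simp [hx, hy, ν.extremal.x_zero, ν.extremal.y_zero]) (fun s _ => hd₁ s)
  have hzero : ∀ s, ν.extremal.h₁ s = 0 → Real.cosh (Real.sqrt ν.r * (φ + s)) ^ 2 = 2 :=
    fun s hs => by
      have e := congrArg Covector.h₁ (h.vertical_eq hν s)
      change ν.extremal.h₁ s = _ at e
      have hC := Real.cosh_pos (Real.sqrt ν.r * (φ + s))
      rw [hs, eq_comm, mul_eq_zero, or_iff_right hr.ne', sub_eq_zero,
        eq_div_iff (by positivity), one_mul] at e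
      exact e
  have habs : ∀ a b, ν.extremal.h₁ a = 0 → ν.extremal.h₁ b = 0 → a < b →
      φ + a = -(φ + b) := fun a b ha hb hab => by
    have hC : Real.cosh (Real.sqrt ν.r * (φ + a)) = Real.cosh (Real.sqrt ν.r * (φ + b)) :=
      (sq_eq_sq₀ (Real.cosh_pos _).le (Real.cosh_pos _).le).1
        ((hzero a ha).trans (hzero b hb).symm)
    rcases abs_eq_abs.1 (le_antisymm (Real.cosh_le_cosh.1 hC.le) (Real.cosh_le_cosh.1 hC.ge))
      with e | e
    · have := mul_left_cancel₀ hρ.ne' e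
      linarith
    · rw [← mul_neg] at e
      exact mul_left_cancel₀ hρ.ne' e
  have e₁ := habs 0 s (by linarith) hs0 hs.1
  have e₂ := habs s t hs0 (by linarith) hs.2
  linarith [habs 0 t (by linarith) (by linarith) ht, hs.1]

end N₃

/-! ### Equilibria and circles -/

/-- The covectors of straight lines are fixed by all reflections. -/
lemma notMem_MAX_of_h₂_h₃_eq_zero {ν : Covector} (h₂ : ν.h₂ = 0) (h₃ : ν.h₃ = 0)
    (i : Reflection) (t : ℝ) : ν ∉ MAX i t := by
  have hv := extremal_vertical_eq (ν := ν) (a := fun _ => ν.h₁) (b := fun _ => 0)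
    (c := fun _ => 0) (fun s => (hasDerivAt_const s _).congr_deriv (by simp))
    (fun s => hasDerivAt_const s _) (fun s => (hasDerivAt_const s _).congr_deriv (by simp))
    (Covector.ext rfl h₂.symm h₃.symm) t
  have hfix : reflect t i ν = ν := by
    cases i
    · simp [reflect₁_eq_self_iff, hv, ν.extremal_vertical_zero, h₂, h₃]
    · simp [reflect₂_eq_self_iff, hv, ν.extremal_vertical_zero, h₂, h₃]
    · exact (reflect₃_eq_self_iff t ν).2 ⟨h₂, h₃⟩
  rintro ⟨⟨s, -, hs⟩, -⟩
  exact hs (by rw [hfix])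

lemma MAX_inter_N₄ (i : Reflection) (t : ℝ) : MAX i t ∩ N₄ = ∅ := by
  refine eq_empty_of_forall_notMem fun ν ⟨hM, hr, hE⟩ => ?_
  have h₁ := neg_abs_le ν.h₁
  have h₁' := ν.abs_h₁_le
  rw [Covector.energy, Covector.c] at hE
  have h₂ : ν.h₂ = 0 :=
    pow_eq_zero_iff two_ne_zero |>.1 (le_antisymm (by linarith) (sq_nonneg ν.h₂))
  have h₃ : ν.h₃ = 0 := by
    have hsq := ν.r_sq
    rw [h₂] at hE
    rw [show ν.h₁ = -ν.r by linarith] at hsq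
    exact pow_eq_zero_iff two_ne_zero |>.1 (by linarith)
  exact notMem_MAX_of_h₂_h₃_eq_zero h₂ h₃ i t hM

lemma MAX_inter_N₅ (i : Reflection) (t : ℝ) : MAX i t ∩ N₅ = ∅ := by
  refine eq_empty_of_forall_notMem fun ν ⟨hM, hr, hE, h₁, h₃⟩ => ?_
  rw [sub_self, Real.cos_zero, mul_one] at h₁
  rw [sub_self, Real.sin_zero, mul_zero] at h₃
  rw [Covector.energy, Covector.c] at hE
  have h₂ : ν.h₂ = 0 := pow_eq_zero_iff two_ne_zero |>.1 (by linarith)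
  exact notMem_MAX_of_h₂_h₃_eq_zero h₂ h₃ i t hM

lemma h₁_h₃_eq_zero_of_r_eq_zero {ν : Covector} (hr : ν.r = 0) : ν.h₁ = 0 ∧ ν.h₃ = 0 := by
  have hsq := ν.r_sq
  rw [hr] at hsq
  constructor <;> nlinarith [sq_nonneg ν.h₁, sq_nonneg ν.h₃]

lemma MAX_inter_N₇ (i : Reflection) (t : ℝ) : MAX i t ∩ N₇ = ∅ :=
  eq_empty_of_forall_notMem fun _ ⟨hM, hr, hc⟩ =>
    notMem_MAX_of_h₂_h₃_eq_zero hc (h₁_h₃_eq_zero_of_r_eq_zero hr).2 i t hM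

section N₆

variable {ν : Covector}

lemma vertical_eq_of_mem_N₆ (hν : ν ∈ N₆) (s : ℝ) : ν.extremal.vertical s = ν := by
  obtain ⟨h₁, h₃⟩ := h₁_h₃_eq_zero_of_r_eq_zero hν.1
  exact extremal_vertical_eq (a := fun _ => ν.h₁) (b := fun _ => ν.h₂) (c := fun _ => ν.h₃)
    (fun s => (hasDerivAt_const s _).congr_deriv (by simp [h₃]))
    (fun s => (hasDerivAt_const s _).congr_deriv h₃.symm)
    (fun s => (hasDerivAt_const s _).congr_deriv (by simp [h₁])) rfl s

lemma reflect₁_ne_self_of_mem_N₆ (hν : ν ∈ N₆) (t : ℝ) : reflect t .ε₁ ν ≠ ν := by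
  intro h
  have h₂ := ((reflect₁_eq_self_iff t ν).1 h).2.1
  rw [vertical_eq_of_mem_N₆ hν, vertical_eq_of_mem_N₆ hν] at h₂
  exact hν.2 (self_eq_neg.1 h₂)

lemma reflect₂_eq_self_of_mem_N₆ (hν : ν ∈ N₆) (t : ℝ) : reflect t .ε₂ ν = ν := by
  rw [reflect₂_eq_self_iff, vertical_eq_of_mem_N₆ hν, vertical_eq_of_mem_N₆ hν,
    (h₁_h₃_eq_zero_of_r_eq_zero hν.1).2]
  simp

lemma reflect₃_ne_self_of_mem_N₆ (hν : ν ∈ N₆) (t : ℝ) : reflect t .ε₃ ν ≠ ν :=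
  fun h => hν.2 ((reflect₃_eq_self_iff t ν).1 h).1

/-- On a circle, the point with the opposite direction is diametrically opposite. -/
lemma Exp_ne_of_mem_N₆ (hν : ν ∈ N₆) (t : ℝ) : Exp t ν ≠ ⟨0, 0, (Real.pi : Real.Angle)⟩ := by
  intro hq
  have hy : ν.extremal.y t = 0 := congrArg Config.y hq
  have hθ : (ν.extremal.θ t : Real.Angle) = (Real.pi : Real.Angle) := congrArg Config.θ hq
  have hcos : Real.cos (ν.extremal.θ t) = -1 := by simpa using congrArg Real.Angle.cos hθ
  have h₂ : ∀ s, ν.extremal.h₂ s = ν.h₂ := fun s =>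
    congrArg Covector.h₂ (vertical_eq_of_mem_N₆ hν s)
  have hd : ∀ s, HasDerivAt (fun s => ν.h₂ * ν.extremal.y s + Real.cos (ν.extremal.θ s)) 0 s :=
    fun s => (((ν.extremal.deriv_y s).const_mul ν.h₂).add
      (ν.extremal.deriv_θ s).cos).congr_deriv (by rw [h₂]; ring)
  have h := is_const_of_deriv_eq_zero (fun s => (hd s).differentiableAt)
    (fun s => (hd s).deriv) t 0
  rw [hy, hcos, ν.extremal.y_zero, ν.extremal.θ_zero, Real.cos_zero] at h
  linarith

end N₆

end Elastica

/-! ### Description of the Maxwell strata -/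

theorem mainTheorem3 (t : ℝ) (ht : 0 < t) :
    -- on `N₁`
    (∀ ν ∈ N₁, ∀ k φ : ℝ, IsEllipticCoord₁ ν k φ →
      ((ν ∈ MAX .ε₁ t ↔ reflect t .ε₁ ν ≠ ν ∧ Exp t (reflect t .ε₁ ν) = Exp t ν) ∧
        (reflect t .ε₁ ν ≠ ν ∧ Exp t (reflect t .ε₁ ν) = Exp t ν ↔
          cn (tau ν φ t) k ≠ 0 ∧
            ((Exp t ν).θ = 0 ∨ Exp t ν = ⟨0, 0, (Real.pi : Real.Angle)⟩))) ∧
      ((ν ∈ MAX .ε₂ t ↔ reflect t .ε₂ ν ≠ ν ∧ Exp t (reflect t .ε₂ ν) = Exp t ν) ∧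
        (reflect t .ε₂ ν ≠ ν ∧ Exp t (reflect t .ε₂ ν) = Exp t ν ↔
          sn (tau ν φ t) k ≠ 0 ∧ (Exp t ν).P = 0)) ∧
      ((ν ∈ MAX .ε₃ t ↔ reflect t .ε₃ ν ≠ ν ∧ Exp t (reflect t .ε₃ ν) = Exp t ν) ∧
        (reflect t .ε₃ ν ≠ ν ∧ Exp t (reflect t .ε₃ ν) = Exp t ν ↔
          (Exp t ν).y = 0 ∧ ((Exp t ν).θ = 0 ∨ (Exp t ν).θ = (Real.pi : Real.Angle))))) ∧
    -- on `N₂`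
    (∀ ν ∈ N₂, ∀ k ψ : ℝ, IsEllipticCoord₂ ν k ψ →
      ((ν ∈ MAX .ε₁ t ↔ reflect t .ε₁ ν ≠ ν ∧ Exp t (reflect t .ε₁ ν) = Exp t ν) ∧
        (reflect t .ε₁ ν ≠ ν ∧ Exp t (reflect t .ε₁ ν) = Exp t ν ↔
          (Exp t ν).θ = 0 ∨ Exp t ν = ⟨0, 0, (Real.pi : Real.Angle)⟩)) ∧
      ((ν ∈ MAX .ε₂ t ↔ reflect t .ε₂ ν ≠ ν ∧ Exp t (reflect t .ε₂ ν) = Exp t ν) ∧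
        (reflect t .ε₂ ν ≠ ν ∧ Exp t (reflect t .ε₂ ν) = Exp t ν ↔
          sn (tau₂ ν k ψ t) k * cn (tau₂ ν k ψ t) k ≠ 0 ∧ (Exp t ν).P = 0)) ∧
      ((ν ∈ MAX .ε₃ t ↔ reflect t .ε₃ ν ≠ ν ∧ Exp t (reflect t .ε₃ ν) = Exp t ν) ∧
        (reflect t .ε₃ ν ≠ ν ∧ Exp t (reflect t .ε₃ ν) = Exp t ν ↔
          (Exp t ν).y = 0 ∧ ((Exp t ν).θ = 0 ∨ (Exp t ν).θ = (Real.pi : Real.Angle))))) ∧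
    -- on `N₃`
    (∀ ν ∈ N₃, ∀ φ : ℝ, IsEllipticCoord₃ ν φ →
      ((ν ∈ MAX .ε₁ t ↔ reflect t .ε₁ ν ≠ ν ∧ Exp t (reflect t .ε₁ ν) = Exp t ν) ∧
        (reflect t .ε₁ ν ≠ ν ∧ Exp t (reflect t .ε₁ ν) = Exp t ν ↔ (Exp t ν).θ = 0)) ∧
      ((ν ∈ MAX .ε₂ t ↔ reflect t .ε₂ ν ≠ ν ∧ Exp t (reflect t .ε₂ ν) = Exp t ν) ∧
        (reflect t .ε₂ ν ≠ ν ∧ Exp t (reflect t .ε₂ ν) = Exp t ν ↔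
          tau ν φ t ≠ 0 ∧ (Exp t ν).P = 0)) ∧
      ((ν ∈ MAX .ε₃ t ↔ reflect t .ε₃ ν ≠ ν ∧ Exp t (reflect t .ε₃ ν) = Exp t ν) ∧
        (reflect t .ε₃ ν ≠ ν ∧ Exp t (reflect t .ε₃ ν) = Exp t ν ↔
          (Exp t ν).y = 0 ∧ ((Exp t ν).θ = 0 ∨ (Exp t ν).θ = (Real.pi : Real.Angle))))) ∧
    -- on `N₄`, `N₅`, `N₇`
    (∀ i : Reflection, MAX i t ∩ N₄ = ∅ ∧ MAX i t ∩ N₅ = ∅ ∧ MAX i t ∩ N₇ = ∅) ∧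
    -- on `N₆`
    (∀ ν ∈ N₆,
      ((ν ∈ MAX .ε₁ t ↔ reflect t .ε₁ ν ≠ ν ∧ Exp t (reflect t .ε₁ ν) = Exp t ν) ∧
        (reflect t .ε₁ ν ≠ ν ∧ Exp t (reflect t .ε₁ ν) = Exp t ν ↔ (Exp t ν).θ = 0)) ∧
      ν ∉ MAX .ε₂ t ∧
      ((ν ∈ MAX .ε₃ t ↔ reflect t .ε₃ ν ≠ ν ∧ Exp t (reflect t .ε₃ ν) = Exp t ν) ∧
        (reflect t .ε₃ ν ≠ ν ∧ Exp t (reflect t .ε₃ ν) = Exp t ν ↔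
          (Exp t ν).y = 0 ∧ ((Exp t ν).θ = 0 ∨ (Exp t ν).θ = (Real.pi : Real.Angle))))) := by
  refine ⟨fun ν hν k φ h => ⟨⟨mem_MAX_iff _ ht ν, ?_⟩, ⟨mem_MAX_iff _ ht ν, ?_⟩,
      mem_MAX_iff _ ht ν, ?_⟩,
    fun ν hν k ψ h => ⟨⟨mem_MAX_iff _ ht ν, ?_⟩, ⟨mem_MAX_iff _ ht ν, ?_⟩,
      mem_MAX_iff _ ht ν, ?_⟩,
    fun ν hν φ h => ⟨⟨mem_MAX_iff _ ht ν, ?_⟩, ⟨mem_MAX_iff _ ht ν, ?_⟩,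
      mem_MAX_iff _ ht ν, ?_⟩,
    fun i => ⟨MAX_inter_N₄ i t, MAX_inter_N₅ i t, MAX_inter_N₇ i t⟩,
    fun ν hν => ⟨⟨mem_MAX_iff _ ht ν, ?_⟩, ?_, mem_MAX_iff _ ht ν, ?_⟩⟩
  · rw [Ne, h.reflect₁_eq_self_iff hν, Exp_reflect₁_eq_iff]
  · rw [Ne, h.reflect₂_eq_self_iff hν, Exp_reflect₂_eq_iff]
  · rw [Exp_reflect₃_eq_iff, and_iff_right (reflect₃_ne_self_of_mem_N₁ hν t)]
  · rw [Exp_reflect₁_eq_iff, and_iff_right (h.reflect₁_ne_self hν t)]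
  · rw [Ne, h.reflect₂_eq_self_iff hν, Exp_reflect₂_eq_iff]
  · rw [Exp_reflect₃_eq_iff, and_iff_right (reflect₃_ne_self_of_mem_N₂ hν t)]
  · rw [Exp_reflect₁_eq_iff, and_iff_right (h.reflect₁_ne_self hν t),
      or_iff_left (h.Exp_ne hν ht)]
  · rw [Ne, h.reflect₂_eq_self_iff hν, Exp_reflect₂_eq_iff]
  · rw [Exp_reflect₃_eq_iff, and_iff_right (reflect₃_ne_self_of_mem_N₃ hν t)]
  · rw [Exp_reflect₁_eq_iff, and_iff_right (reflect₁_ne_self_of_mem_N₆ hν t),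
      or_iff_left (Exp_ne_of_mem_N₆ hν t)]
  · rw [mem_MAX_iff _ ht]
    exact fun h => h.1 (reflect₂_eq_self_of_mem_N₆ hν t)
  · rw [Exp_reflect₃_eq_iff, and_iff_right (reflect₃_ne_self_of_mem_N₆ hν t)]
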